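/- **Conventions.** An action of a group $G$ by homeomorphisms on a non-empty compact metrizable space $M$ is a *convergence action* if for every sequence $(g_n)$ of pairwise distinct elements of $G$ there are a subsequence $(g_{\sigma(n)})$ and points $\xi,\eta\in M$ (possibly equal) such that $g_{\sigma(n)}|_K\to\xi$ uniformly for every compact $K\subset M\setminus\{\eta\}$. For a subgroup $H\le G$, the *limit set* $\Lambda(H)\subset M$ is the set of all points $\xi$ for which there are a sequence $(h_n)$ of pairwise distinct elements of $H$ and a point $\eta\in M$ with $h_n|_K\to\xi$ uniformly for every compact $K\subset M\setminus\{\eta\}$. The action is *non-elementary* if $\Lambda(G)$ has at least three points. The subgroup $H$ is *dynamically malnormal* if $g\Lambda(H)\cap\Lambda(H)=\emptyset$ for every $g\in G\setminus H$. **Proposition 1.4.** Let $\Gamma$ be the fundamental group of a finite connected graph of groups with countable vertex groups $\Gamma_v$ and infinite cyclic edge groups. Suppose that every vertex group $\Gamma_v$ is given a convergence action on a compact metrizable space $X_v$, and that for every edge $e$ the images of the edge group $\Gamma_e$ in the vertex groups at its two ends are dynamically malnormal with respect to these actions. Then $\Gamma$ is a convergence group: there is a non-empty compact metrizable space $M$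 with a convergence action of $\Gamma$. Moreover, if the action of at least one vertex group $\Gamma_v$ on $X_v$ is non-elementary, then $M$ and the action can be chosen so that the action of $\Gamma$ on $M$ is non-elementary. -/

import Mathlib

open Filter Topology

namespace ConvGroups

section Convergence

variable {G : Type*} [Group G] {M : Type*} [TopologicalSpace M] [MulAction G M]

/-- The sequence `g n` converges to the point `ξ` uniformly on all compact subsets of `M \ {η}`. -/
def ConvergesOff (g : ℕ → G) (ξ η : M) : Prop :=
  ∀ K : Set M, IsCompact K → η ∉ K → ∀ U ∈ 𝓝 ξ, ∀ᶠ n in atTop, ∀ x ∈ K, g n • x ∈ U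

variable (G M) in
/-- `G` acts on `M` by homeomorphisms as a (discrete) convergence group: every sequence of
pairwise distinct elements of `G` has a subsequence converging to some point `ξ`, uniformly on
compact subsets of the complement of some point `η`. -/
structure IsConvergenceAction : Prop where
  nonempty : Nonempty M
  continuous_smul : ContinuousConstSMul G M
  exists_subseq : ∀ g : ℕ → G, Function.Injective g →
    ∃ σ : ℕ → ℕ, StrictMono σ ∧ ∃ ξ η : M, ConvergesOff (g ∘ σ) ξ η

variable (M) in
/-- The limit set of a subgroup `H`: all points to which some sequence of pairwise distinct
elements of `H` converges, uniformly on compact subsets of the complement of a point. -/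
def limitSet (H : Subgroup G) : Set M :=
  {ξ | ∃ h : ℕ → G, Function.Injective h ∧ (∀ n, h n ∈ H) ∧ ∃ η : M, ConvergesOff h ξ η}

variable (G M) in
/-- The action is non-elementary: its limit set has at least three points. -/
def IsNonElementary : Prop :=
  3 ≤ (limitSet M (⊤ : Subgroup G)).encard

variable (M) in
/-- `H` is dynamically malnormal: `gΛ(H) ∩ Λ(H) = ∅` for every `g ∈ G \ H`. -/
def IsDynamicallyMalnormal (H : Subgroup G) : Prop :=
  ∀ g : G, g ∉ H → Disjoint ((fun x : M => g • x) '' limitSet M H) (limitSet M H)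

end Convergence

/-- A graph of groups with vertex set `V` and (unoriented) edge set `E`, vertex groups `G v` and
edge groups `C e`. Loops and multiple edges are allowed; every edge is listed once, with an
arbitrary choice of orientation. -/
structure GraphOfGroups (V E : Type*) (G : V → Type*) (C : E → Type*)
    [∀ v, Group (G v)] [∀ e, Group (C e)] where
  src : E → V
  tgt : E → V
  srcHom : ∀ e, C e →* G (src e)
  tgtHom : ∀ e, C e →* G (tgt e)
  srcHom_injective : ∀ e, Function.Injective (srcHom e)
  tgtHom_injective : ∀ e, Function.Injective (tgtHom e)

namespace GraphOfGroups

variable {V E : Type*} {G : V → Type*} {C : E → Type*} [∀ v, Group (G v)] [∀ e, Group (C e)]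

/-- The edges in `T` (together with all vertices) form a spanning tree of the underlying graph:
no edge of `T` is a loop, no two edges of `T` are parallel, and the resulting simple graph is a
tree. -/
structure IsSpanningTree (Y : GraphOfGroups V E G C) (T : Set E) : Prop where
  not_loop : ∀ e ∈ T, Y.src e ≠ Y.tgt e
  injOn : Set.InjOn (fun e => s(Y.src e, Y.tgt e)) T
  isTree : (SimpleGraph.fromEdgeSet ((fun e => s(Y.src e, Y.tgt e)) '' T)).IsTree

/-- The free product of all vertex groups and of the free group on the stable letters. -/
abbrev FreeProd (_ : GraphOfGroups V E G C) : Type _ :=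
  Monoid.Coprod (Monoid.CoprodI G) (FreeGroup E)

/-- The vertex group `G v` inside the free product. -/
def vertexHom (Y : GraphOfGroups V E G C) (v : V) : G v →* Y.FreeProd :=
  Monoid.Coprod.inl.comp Monoid.CoprodI.of

/-- The stable letter of the edge `e`. -/
def stableLetter (Y : GraphOfGroups V E G C) (e : E) : Y.FreeProd :=
  Monoid.Coprod.inr (FreeGroup.of e)

/-- The relators `tₑ · srcHom(c) · tₑ⁻¹ · tgtHom(c)⁻¹` for all edges `e` and all `c` in the edge
group, and `tₑ` for the edges `e` of the spanning tree `T`. -/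
def relators (Y : GraphOfGroups V E G C) (T : Set E) : Set Y.FreeProd :=
  {r | ∃ (e : E) (c : C e), r = Y.stableLetter e * Y.vertexHom (Y.src e) (Y.srcHom e c) *
      (Y.stableLetter e)⁻¹ * (Y.vertexHom (Y.tgt e) (Y.tgtHom e c))⁻¹} ∪
    Y.stableLetter '' T

/-- The fundamental group of the graph of groups `Y` with respect to the spanning tree `T`. -/
abbrev FundamentalGroup (Y : GraphOfGroups V E G C) (T : Set E) : Type _ :=
  Y.FreeProd ⧸ Subgroup.normalClosure (Y.relators T)

end GraphOfGroups

end ConvGroups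

namespace ConvGroups

/-! If no vertex action is non-elementary, a one-point space suffices. Otherwise fix a vertex group
`A` acting non-elementarily on `X`; the space `M` is assembled from translates of a quotient of `X`,
arranged along the Bass-Serre tree.

The quotient `X'` collapses every `A`-translate of the limit set of every incident edge group to a
point (`exists_collapse`). Malnormality makes these translates equal or disjoint. The key dynamical
fact, `eq_of_tendsto_of_distinct_cosets`, is that a limit point of a malnormal cyclic subgroup is
not conical along distinct cosets. Hence distinct translates can only accumulate at single points,
the relation is closed and `X'` is metrizable. Each incident edge group now fixes a single marked
point, which is non-conical (`isNonconical_of_collapse`).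

For `γ`, `δ` in different cosets of `A`, the first edge of the geodesic from the vertex of `γ` to
that of `δ` marks a point `d (γ⁻¹ * δ)` of `X'`, the direction in which `γX'` sees `δX'`. The space
`treeSpace` consists of the families of points, one in each translate, such that for any two
translates at least one coordinate points at the other translate. It is closed in a countable power
of `X'`, hence compact metrizable. A sequence in `Γ` either moves every translate away from every
other one, and then the tree alone forces convergence (`treeSpace.convergesOff_of_escaping`), or
along a subsequence it is `w * a n * u⁻¹` with `a n` in `A`, and convergence in `X'` spreads to the
whole space because all directions are non-conical (`treeSpace.convergesOff_embed`).

The Bass-Serre tree and the injectivity of the vertex groups come from a ping-pong action of the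
presented group on `ℕ` (`GraphOfGroups.IsSpanningTree.exists_isPingPong`): the half-spaces of this
action certify that the coset graph is a tree. -/

theorem exists_subseq_const_or_injective {α : Type*} (f : ℕ → α) :
    ∃ σ : ℕ → ℕ, StrictMono σ ∧ ((∀ n, f (σ n) = f (σ 0)) ∨ Function.Injective (f ∘ σ)) := by
  obtain ⟨g, h | h⟩ := exists_increasing_or_nonincreasing_subseq (fun a b : α => a = b) f
  · refine ⟨g, g.strictMono, Or.inl fun n => ?_⟩
    rcases Nat.eq_zero_or_pos n with rfl | hn
    · rfl
    · exact (h 0 n hn).symm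
  · refine ⟨g, g.strictMono, Or.inr fun m n hmn => ?_⟩
    by_contra hne
    rcases lt_or_gt_of_ne hne with hlt | hlt
    · exact h m n hlt hmn
    · exact h n m hlt hmn.symm

theorem exists_subseq_const {α : Type*} [Finite α] (f : ℕ → α) :
    ∃ σ : ℕ → ℕ, StrictMono σ ∧ ∃ a, ∀ n, f (σ n) = a := by
  obtain ⟨σ, hσ, h | h⟩ := exists_subseq_const_or_injective f
  · exact ⟨σ, hσ, _, h⟩
  · exact absurd h (not_injective_infinite_finite _)

/-! ### Convergence sequences and limit sets of cyclic subgroups -/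

section Dynamics

variable {G : Type*} [Group G] {X : Type*} [TopologicalSpace X] [MulAction G X]

namespace ConvergesOff

variable {g : ℕ → G} {ξ η : X}

theorem comp (h : ConvergesOff g ξ η) {σ : ℕ → ℕ} (hσ : StrictMono σ) :
    ConvergesOff (g ∘ σ) ξ η := fun K hK hη U hU =>
  hσ.tendsto_atTop.eventually (h K hK hη U hU)

theorem tendsto [CompactSpace X] [T2Space X] (h : ConvergesOff g ξ η) {x : ℕ → X} {a : X}
    (hx : Tendsto x atTop (𝓝 a)) (ha : a ≠ η) : Tendsto (fun n => g n • x n) atTop (𝓝 ξ) := by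
  intro U hU
  obtain ⟨K, hK, hKη, hKc⟩ := local_compact_nhds (isOpen_ne.mem_nhds ha)
  have h1 := h K hKc (fun hη => hKη hη rfl) U hU
  have h2 : ∀ᶠ n in atTop, x n ∈ K := hx hK
  change ∀ᶠ n in atTop, g n • x n ∈ U
  filter_upwards [h1, h2] with n hn hxn using hn _ hxn

theorem tendsto_const [CompactSpace X] [T2Space X] (h : ConvergesOff g ξ η) {a : X}
    (ha : a ≠ η) : Tendsto (fun n => g n • a) atTop (𝓝 ξ) :=
  h.tendsto tendsto_const_nhds ha

/-- North-south dynamics reverses by taking complements: `g n` eventually carries the complement of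
`U` into the complement of `K`. -/
theorem inv [CompactSpace X] [T2Space X] (h : ConvergesOff g ξ η) :
    ConvergesOff (fun n => (g n)⁻¹) η ξ := by
  intro K hK hξ U hU
  have h1 := h (interior U)ᶜ isOpen_interior.isClosed_compl.isCompact
    (fun hη => hη (mem_interior_iff_mem_nhds.2 hU)) Kᶜ (hK.isClosed.isOpen_compl.mem_nhds hξ)
  filter_upwards [h1] with n hn y hy
  by_contra hU'
  have := hn ((g n)⁻¹ • y) (fun hi => hU' (interior_subset hi))
  rw [smul_inv_smul] at this
  exact this hy

theorem mul_left [ContinuousConstSMul G X] (h : ConvergesOff g ξ η) (a : G) :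
    ConvergesOff (fun n => a * g n) (a • ξ) η := by
  intro K hK hη U hU
  have h1 := h K hK hη _ ((continuous_const_smul a).continuousAt.preimage_mem_nhds hU)
  filter_upwards [h1] with n hn x hx
  rw [mul_smul]
  exact hn x hx

theorem mul_right [ContinuousConstSMul G X] (h : ConvergesOff g ξ η) (b : G) :
    ConvergesOff (fun n => g n * b) ξ (b⁻¹ • η) := by
  intro K hK hη U hU
  have h1 := h ((fun x => b • x) '' K) (hK.image (continuous_const_smul b))
    (by rintro ⟨x, hx, rfl⟩; exact hη (by simpa using hx)) U hU
  filter_upwards [h1] with n hn x hx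
  rw [mul_smul]
  exact hn _ ⟨x, hx, rfl⟩

/-- A third point, off both repelling points, is drawn to both attracting points. The same argument
for the inverses settles the repelling points. -/
theorem unique [CompactSpace X] [T2Space X] (h3 : ∀ a b : X, ∃ c, c ≠ a ∧ c ≠ b)
    (h : ConvergesOff g ξ η) {ξ' η' : X} (h' : ConvergesOff g ξ' η') : ξ = ξ' ∧ η = η' := by
  have key : ∀ {f : ℕ → G} {a b a' b' : X}, ConvergesOff f a b → ConvergesOff f a' b' → a = a' := by
    intro f a b a' b' hf hf'
    obtain ⟨c, hc, hc'⟩ := h3 b b'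
    exact tendsto_nhds_unique (hf.tendsto_const hc) (hf'.tendsto_const hc')
  exact ⟨key h h', key h.inv h'.inv⟩

end ConvergesOff

/-- In a compact metrizable space it suffices to test `ConvergesOff` on convergent sequences. -/
theorem convergesOff_of_seq [CompactSpace X] [TopologicalSpace.MetrizableSpace X] {g : ℕ → G}
    {ξ η : X}
    (h : ∀ σ : ℕ → ℕ, StrictMono σ → ∀ (x : ℕ → X) (a b : X), Tendsto x atTop (𝓝 a) →
      Tendsto (fun n => g (σ n) • x n) atTop (𝓝 b) → a ≠ η → b ≠ ξ → False) :
    ConvergesOff g ξ η := by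
  intro K hK hη U hU
  by_contra hcon
  rw [not_eventually] at hcon
  obtain ⟨σ, hσ, hbad⟩ := extraction_of_frequently_atTop hcon
  simp only [not_forall] at hbad
  choose x hxK hxU using hbad
  obtain ⟨a, haK, τ, hτ, hxa⟩ := hK.tendsto_subseq hxK
  obtain ⟨b, ρ, hρ, hb⟩ := CompactSpace.tendsto_subseq (fun n => g (σ (τ n)) • x (τ n))
  refine h (σ ∘ τ ∘ ρ) (hσ.comp (hτ.comp hρ)) (x ∘ τ ∘ ρ) a b
    (hxa.comp hρ.tendsto_atTop) hb (fun e => hη (e ▸ haK)) ?_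
  rintro rfl
  obtain ⟨n, hn⟩ := (hb.eventually hU).exists
  exact hxU _ hn

/-- No sequence of distinct elements almost maps three distinct points to distinct points. -/
theorem IsConvergenceAction.not_three [CompactSpace X] [T2Space X] (hX : IsConvergenceAction G X)
    {f : ℕ → G} (hf : Function.Injective f) {x y z : ℕ → X} {a b c a' b' c' : X}
    (hx : Tendsto x atTop (𝓝 a)) (hy : Tendsto y atTop (𝓝 b)) (hz : Tendsto z atTop (𝓝 c))
    (hx' : Tendsto (fun n => f n • x n) atTop (𝓝 a'))
    (hy' : Tendsto (fun n => f n • y n) atTop (𝓝 b'))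
    (hz' : Tendsto (fun n => f n • z n) atTop (𝓝 c'))
    (hab : a ≠ b) (hac : a ≠ c) (hbc : b ≠ c) (hab' : a' ≠ b') (hac' : a' ≠ c') (hbc' : b' ≠ c') :
    False := by
  obtain ⟨σ, hσ, ξ, η, h⟩ := hX.exists_subseq f hf
  have key : ∀ {u : ℕ → X} {p q : X}, Tendsto u atTop (𝓝 p) →
      Tendsto (fun n => f n • u n) atTop (𝓝 q) → p ≠ η → q = ξ := fun hu hu' hp =>
    tendsto_nhds_unique (hu'.comp hσ.tendsto_atTop) (h.tendsto (hu.comp hσ.tendsto_atTop) hp)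
  by_cases ha : a = η
  · exact hbc' ((key hy hy' (fun e => hab (ha.trans e.symm))).trans
      (key hz hz' (fun e => hac (ha.trans e.symm))).symm)
  · by_cases hb : b = η
    · exact hac' ((key hx hx' ha).trans (key hz hz' (fun e => hbc (hb.trans e.symm))).symm)
    · exact hab' ((key hx hx' ha).trans (key hy hy' hb).symm)

theorem smul_mem_limitSet [ContinuousConstSMul G X] {H K : Subgroup G} {g : G}
    (hg : ∀ h ∈ H, g * h * g⁻¹ ∈ K) {x : X} (hx : x ∈ limitSet X H) : g • x ∈ limitSet X K := by
  obtain ⟨f, hf, hfH, η, h⟩ := hx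
  refine ⟨fun n => g * f n * g⁻¹, fun m n hmn => hf (by simpa using hmn), fun n => hg _ (hfH n),
    g • η, ?_⟩
  simpa using (h.mul_left g).mul_right g⁻¹

section Cyclic

variable [CompactSpace X] [T2Space X] (hX : IsConvergenceAction G X)
  (h3 : ∀ a b : X, ∃ c, c ≠ a ∧ c ≠ b)

include hX h3

/-- Conjugation by `h` fixes each `f n` and moves the limit pair by `h`, so uniqueness of the pair
applies. -/
theorem smul_eq_of_mem_zpowers {h : G} {f : ℕ → G} (hf : ∀ n, f n ∈ Subgroup.zpowers h) {ξ η : X}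
    (hc : ConvergesOff f ξ η) : h • ξ = ξ ∧ h • η = η := by
  have := hX.continuous_smul
  have h1 := (hc.mul_left h).mul_right h⁻¹
  have h2 : (fun n => h * f n * h⁻¹) = f := by
    funext n
    obtain ⟨k, hk⟩ := hf n
    rw [← hk]
    group
  rw [h2] at h1
  have := h1.unique h3 hc
  simpa using this

/-- All elements of the cyclic group fix `ξ` and `η`. A fixed point other than the repelling point
of a sequence must be its attracting point, so no further limit points arise. -/
theorem exists_limitSet_zpowers {h : G} (hh : Function.Injective fun n : ℕ => h ^ n) :
    ∃ (σ : ℕ → ℕ) (ξ η : X), StrictMono σ ∧ ConvergesOff (fun k => h ^ σ k) ξ η ∧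
      h • ξ = ξ ∧ h • η = η ∧ limitSet X (Subgroup.zpowers h) = {ξ, η} := by
  obtain ⟨σ, hσ, ξ, η, hc⟩ := hX.exists_subseq _ hh
  have hmem : ∀ k, h ^ σ k ∈ Subgroup.zpowers h := fun k => Subgroup.npow_mem_zpowers h _
  obtain ⟨hξ, hη⟩ := smul_eq_of_mem_zpowers hX h3 hmem hc
  refine ⟨σ, ξ, η, hσ, hc, hξ, hη, Set.Subset.antisymm ?_ ?_⟩
  · rintro α ⟨f, hf, hfH, β, hfc⟩
    obtain ⟨hα, hβ⟩ := smul_eq_of_mem_zpowers hX h3 hfH hfc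
    have hfix : ∀ {x : X}, h • x = x → ∀ n, f n • x = x := by
      intro x hx n
      have : h ∈ MulAction.stabilizer G x := hx
      exact (Subgroup.zpowers_le.2 this) (hfH n)
    have hlim : ∀ {x : X}, h • x = x → x ≠ β → x = α := by
      intro x hx hxβ
      have := hfc.tendsto_const hxβ
      simp only [hfix hx] at this
      exact tendsto_nhds_unique tendsto_const_nhds this
    by_cases h1 : ξ = β
    · by_cases h2 : η = β
      · by_contra hcon
        simp only [Set.mem_insert_iff, Set.mem_singleton_iff, not_or] at hcon
        have h4 : Tendsto (fun n => h ^ σ n • α) atTop (𝓝 ξ) := hc.tendsto_const hcon.2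
        have h5 : ∀ n : ℕ, h ^ n • α = α := fun n =>
          (MulAction.stabilizer G α).pow_mem (show h ∈ MulAction.stabilizer G α from hα) n
        simp only [h5] at h4
        exact hcon.1 (tendsto_nhds_unique tendsto_const_nhds h4)
      · exact Or.inr (hlim hη h2).symm
    · exact Or.inl (hlim hξ h1).symm
  · have hinj : Function.Injective fun k => h ^ σ k := hh.comp hσ.injective
    rintro α (rfl | rfl)
    · exact ⟨_, hinj, hmem, _, hc⟩
    · exact ⟨_, inv_injective.comp hinj, fun n => inv_mem (hmem n), _, hc.inv⟩

/-- Passing to the inverse generator if necessary, any chosen limit point may be assumed attracting.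
-/
theorem exists_generator_tendsto {h : G} (hh : Function.Injective fun n : ℕ => h ^ n) {p : X}
    (hp : p ∈ limitSet X (Subgroup.zpowers h)) :
    ∃ (h' : G) (p' : X) (σ : ℕ → ℕ), Subgroup.zpowers h' = Subgroup.zpowers h ∧
      (Function.Injective fun n : ℕ => h' ^ n) ∧ StrictMono σ ∧
      ConvergesOff (fun k => h' ^ σ k) p p' ∧ h' • p = p ∧ h' • p' = p' ∧
      limitSet X (Subgroup.zpowers h) = {p, p'} := by
  obtain ⟨σ, ξ, η, hσ, hc, hξ, hη, hL⟩ := exists_limitSet_zpowers hX h3 hh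
  rw [hL] at hp
  rcases hp with rfl | rfl
  · exact ⟨h, η, σ, rfl, hh, hσ, hc, hξ, hη, hL⟩
  · refine ⟨h⁻¹, ξ, σ, Subgroup.zpowers_inv, ?_, hσ, ?_, ?_, ?_, hL.trans (Set.pair_comm _ _)⟩
    · simp only [inv_pow]
      exact inv_injective.comp hh
    · simpa only [inv_pow] using hc.inv
    · rw [inv_smul_eq_iff, hη]
    · rw [inv_smul_eq_iff, hξ]

/-- A point of the limit set of a dynamically malnormal cyclic subgroup is not a conical limit
point, along sequences in pairwise distinct cosets. -/
theorem eq_of_tendsto_of_distinct_cosets [FirstCountableTopology X] {h : G}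
    (hh : Function.Injective fun n : ℕ => h ^ n)
    (hmal : IsDynamicallyMalnormal X (Subgroup.zpowers h)) {b : ℕ → G} {p q η : X}
    (hp : p ∈ limitSet X (Subgroup.zpowers h))
    (hcos : ∀ m n, (b m)⁻¹ * b n ∈ Subgroup.zpowers h → m = n)
    (hb : ConvergesOff b η p) (hq : Tendsto (fun n => b n • p) atTop (𝓝 q)) : q = η := by
  have := hX.continuous_smul
  by_contra hne
  obtain ⟨h', p', σ, hH, hh', hσ, hc, hfp, hfp', hL⟩ := exists_generator_tendsto hX h3 hh hp
  rw [← hH] at hmal hcos hL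
  clear hp hH hh h
  obtain ⟨d, hdp, hdp'⟩ := h3 p p'
  obtain ⟨V, U, hVo, hUo, hqV, hηU, hVU⟩ := t2_separation hne
  have hdisj : ∀ {x}, x ∈ V → x ∉ U := fun hx hx' => Set.disjoint_left.1 hVU hx hx'
  have hpow : ∀ k : ℕ, h' ^ k ∈ Subgroup.zpowers h' := fun k => Subgroup.npow_mem_zpowers h' k
  have hpowp : ∀ k : ℕ, h' ^ k • p = p := fun k =>
    (MulAction.stabilizer G p).pow_mem (show h' ∈ MulAction.stabilizer G p from hfp) k
  have hpowp' : ∀ k : ℕ, h' ^ k • p' = p' := fun k =>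
    (MulAction.stabilizer G p').pow_mem (show h' ∈ MulAction.stabilizer G p' from hfp') k
  have hpowne : ∀ k : ℕ, h' ^ k • d ≠ p := fun k e => hdp (by
    rw [← hpowp k] at e; exact MulAction.injective _ e)
  -- For large `n` the orbit `b n • h' ^ k • d` starts near `η` and later comes close to `b n • p`,
  -- which lies in `V`. The last index before the first exit from `U` gives a rescaling `g n = b n *
  -- h' ^ j n` with `g n • d` inside `U` and `g n • h' • d` outside it.
  have htr : ∀ᶠ n in atTop, ∃ j : ℕ, b n • h' ^ j • d ∈ U ∧ b n • h' ^ (j + 1) • d ∉ U := by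
    have h1 : ∀ᶠ n in atTop, b n • d ∈ U := (hb.tendsto_const hdp) (hUo.mem_nhds hηU)
    have h2 : ∀ᶠ n in atTop, b n • p ∈ V := hq (hVo.mem_nhds hqV)
    filter_upwards [h1, h2] with n hn1 hn2
    have h3 : ∃ k : ℕ, b n • h' ^ k • d ∉ U := by
      have h4 : Tendsto (fun k => b n • h' ^ σ k • d) atTop (𝓝 (b n • p)) :=
        ((continuous_const_smul (b n)).tendsto p).comp (hc.tendsto_const hdp')
      obtain ⟨k, hk⟩ := (h4.eventually (hVo.mem_nhds hn2)).exists
      exact ⟨_, hdisj hk⟩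
    classical
    have hspec := Nat.find_spec h3
    have hmin := fun m => Nat.find_min h3 (m := m)
    rcases hk : Nat.find h3 with _ | j
    · rw [hk] at hspec; simp [hn1] at hspec
    · rw [hk] at hspec hmin
      exact ⟨j, not_not.1 (hmin j (Nat.lt_succ_self j)), hspec⟩
  obtain ⟨N, hN⟩ := eventually_atTop.1 htr
  have hshift : StrictMono fun n : ℕ => n + N := fun _ _ h => by simpa using h
  have hN' : ∀ n, ∃ j : ℕ, b (n + N) • h' ^ j • d ∈ U ∧ b (n + N) • h' ^ (j + 1) • d ∉ U :=
    fun n => hN _ (Nat.le_add_left _ _)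
  choose j hj1 hj2 using hN'
  have hgcos : ∀ m n, (b (m + N) * h' ^ j m)⁻¹ * (b (n + N) * h' ^ j n) ∈
      Subgroup.zpowers h' → m = n := by
    intro m n hmn
    have h1 := mul_mem (mul_mem (hpow (j m)) hmn) (inv_mem (hpow (j n)))
    have h2 := hcos (m + N) (n + N) (by convert h1 using 1; group)
    omega
  have hginj : Function.Injective fun n => b (n + N) * h' ^ j n := fun m n hmn =>
    hgcos m n (by
      have hmn' : b (m + N) * h' ^ j m = b (n + N) * h' ^ j n := hmn
      rw [hmn', inv_mul_cancel]; exact one_mem _)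
  obtain ⟨τ, hτ, α, β, hg⟩ := hX.exists_subseq _ hginj
  set g : ℕ → G := (fun n => b (n + N) * h' ^ j n) ∘ τ with hgdef
  set c : ℕ → G := fun n => b (τ n + N) with hcdef
  have hgc : ∀ n, g n = c n * h' ^ j (τ n) := fun n => rfl
  have hρ : StrictMono fun n => τ n + N := hshift.comp hτ
  have hcη : ConvergesOff c η p := hb.comp hρ
  have hcq : Tendsto (fun n => c n • p) atTop (𝓝 q) := hq.comp hρ.tendsto_atTop
  have hgp : Tendsto (fun n => g n • p) atTop (𝓝 q) := by
    simpa only [hgc, mul_smul, hpowp] using hcq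
  have hgU : ∀ n, g n • d ∈ U := fun n => by rw [hgc, mul_smul]; exact hj1 _
  have hgU' : ∀ n, g n • h' • d ∉ U := fun n => by
    rw [hgc, mul_smul, smul_smul _ h', ← pow_succ]; exact hj2 _
  have hαq : Tendsto (fun n => g n • d) atTop (𝓝 q) → False := fun ht => by
    obtain ⟨n, hn⟩ := (ht.eventually (hVo.mem_nhds hqV)).exists
    exact hdisj hn (hgU n)
  have hαη : Tendsto (fun n => g n • h' • d) atTop (𝓝 η) → False := fun ht => by
    obtain ⟨n, hn⟩ := (ht.eventually (hUo.mem_nhds hηU)).exists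
    exact hgU' n hn
  have hdhp : h' • d ≠ p := by simpa using hpowne 1
  -- If the rescaled sequence repels from `p`, then `g n • d` and `g n • h' • d` share the limit
  -- `α`, which is therefore neither `q` nor `η`.
  by_cases hβp : β = p
  · subst hβp
    have hd := hg.tendsto_const hdp
    have hd' := hg.tendsto_const hdhp
    have hcd := hcη.tendsto_const hdp
    have hcd' := hcη.tendsto_const hdhp
    by_cases hpp : p' = β
    · subst hpp
      -- Parabolic case: the conjugates `g n * h' * (g n)⁻¹` almost fix the three distinct points
      -- `q`, `α`, `η`. They are pairwise distinct: if two agree, `(g m)⁻¹ * g n` commutes with `h'`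
      -- and fixes its only fixed point, so malnormality puts it in the cyclic group, against
      -- distinctness of cosets.
      have hfinj : Function.Injective fun n => g n * h' * (g n)⁻¹ := by
        intro m n hmn
        have hmn' : g m * h' * (g m)⁻¹ = g n * h' * (g n)⁻¹ := hmn
        have hcomm : h' * ((g m)⁻¹ * g n) = ((g m)⁻¹ * g n) * h' := by
          have h1 : h' = (g m)⁻¹ * (g m * h' * (g m)⁻¹) * g m := by group
          rw [hmn'] at h1
          calc h' * ((g m)⁻¹ * g n) = ((g m)⁻¹ * (g n * h' * (g n)⁻¹) * g m) * ((g m)⁻¹ * g n) := by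
                rw [← h1]
            _ = _ := by group
        have hfix : h' • ((g m)⁻¹ * g n) • p' = ((g m)⁻¹ * g n) • p' := by
          rw [smul_smul, hcomm, mul_smul, hfp]
        have hfixpow : ∀ k : ℕ, h' ^ k • ((g m)⁻¹ * g n) • p' = ((g m)⁻¹ * g n) • p' := fun k =>
          (MulAction.stabilizer G _).pow_mem (show h' ∈ MulAction.stabilizer G _ from hfix) k
        have hpeq : ((g m)⁻¹ * g n) • p' = p' := by
          by_contra hcon
          have h1 := hc.tendsto_const hcon
          simp only [hfixpow] at h1
          exact hcon (tendsto_nhds_unique tendsto_const_nhds h1)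
        have hmemH : (g m)⁻¹ * g n ∈ Subgroup.zpowers h' := by
          by_contra hcon
          have h1 := Set.disjoint_left.1 (hmal _ hcon) ⟨p', by rw [hL]; simp, rfl⟩
          simp only [hpeq] at h1
          exact h1 (by rw [hL]; simp)
        exact hτ.injective (hgcos _ _ hmemH)
      refine hX.not_three hfinj hgp hd hcd (a' := q) (b' := α) (c' := η) ?_ ?_ ?_
        (fun e => hαq (e ▸ hd)) hne (fun e => hαη (e ▸ hd')) (fun e => hαq (e ▸ hd)) hne
        (fun e => hαη (e ▸ hd'))
      · simpa only [mul_smul, inv_smul_smul, hfp] using hgp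
      · simpa only [mul_smul, inv_smul_smul] using hd'
      · have : ∀ n, (g n * h' * (g n)⁻¹) • c n • d = c n • h' • d := by
          intro n
          rw [hgc, smul_smul, smul_smul]
          congr 1
          group
        simpa only [this] using hcd'
    -- Loxodromic case: `p'` is fixed by the powers of `h'`, so `g n` and `c n` agree on it and `α =
    -- η`.
    · have h1 := hg.tendsto_const hpp
      have h2 := hcη.tendsto_const hpp
      simp only [hgc, mul_smul, hpowp'] at h1
      have := tendsto_nhds_unique h1 h2
      subst this
      exact hαη hd'
  -- If the repelling point is not `p`, the attracting point is `q`. Since `g n • d` stays in `U`,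
  -- away from `q`, the repelling point has to be `d`.
  · have hα : α = q := tendsto_nhds_unique (hg.tendsto_const (Ne.symm hβp)) hgp
    subst hα
    have hβd : d = β := by
      by_contra hcon
      exact hαq (hg.tendsto_const hcon)
    by_cases hpp : p' = p
    · subst hpp
      obtain ⟨ρ, hρ', hconst | hinj⟩ := exists_subseq_const_or_injective fun n => j (τ n)
      · have h1 := (hcη.tendsto_const (hpowne (j (τ (ρ 0)) + 1))).comp hρ'.tendsto_atTop
        obtain ⟨n, hn⟩ := (h1.eventually (hUo.mem_nhds hηU)).exists
        have h2 := hj2 (τ (ρ n))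
        rw [hconst n] at h2
        exact h2 hn
      -- With unbounded exponents, `h' ^ (-j)` moves `d` to the parabolic point `p`, which `g n`
      -- sends to `q`. The composite is `c n • d`, which tends to `η`.
      · have hfinj : Function.Injective fun n => (h' ^ (j (τ (ρ n))))⁻¹ :=
          inv_injective.comp (hh'.comp hinj)
        obtain ⟨κ, hκ, α', β', hh2⟩ := hX.exists_subseq _ hfinj
        have hmem : ∀ n, ((fun n => (h' ^ (j (τ (ρ n))))⁻¹) ∘ κ) n ∈ Subgroup.zpowers h' :=
          fun n => inv_mem (hpow _)
        have hα' : α' ∈ limitSet X (Subgroup.zpowers h') := ⟨_, hfinj.comp hκ.injective, hmem, _, hh2⟩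
        have hβ' : β' ∈ limitSet X (Subgroup.zpowers h') :=
          ⟨_, inv_injective.comp (hfinj.comp hκ.injective), fun n => inv_mem (hmem n), _, hh2.inv⟩
        rw [hL] at hα' hβ'
        simp only [Set.mem_insert_iff, Set.mem_singleton_iff, or_self] at hα' hβ'
        subst hα' hβ'
        have h1 := hh2.tendsto_const hdp
        have h2 := ((hg.comp hρ').comp hκ).tendsto h1 (Ne.symm hβp)
        have h4 := ((hcη.tendsto_const hdp).comp hρ'.tendsto_atTop).comp hκ.tendsto_atTop
        refine hne (tendsto_nhds_unique h2 (h4.congr fun n => ?_))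
        simp only [Function.comp, hgc, smul_smul]
        congr 1
        simp [hcdef]
    · have hp'β : p' ≠ β := fun e => hdp' (hβd.trans e.symm)
      have h1 := hg.tendsto_const hp'β
      have h2 := hcη.tendsto_const hpp
      simp only [hgc, mul_smul, hpowp'] at h1
      exact hne (tendsto_nhds_unique h1 h2)

end Cyclic

end Dynamics


/-! ### Quotients of compact metrizable spaces by closed equivalence relations -/

section Quotient

variable {X : Type*} [TopologicalSpace X] {s : Setoid X}

/-- The saturation of a closed set is a projection of a closed subset of the compact square. -/
theorem isClosedMap_quotientMk [CompactSpace X]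
    (hs : IsClosed {z : X × X | s z.1 z.2}) : IsClosedMap (Quotient.mk s) := by
  intro F hF
  rw [← isQuotientMap_quotient_mk'.isClosed_preimage]
  have : (Quotient.mk s) ⁻¹' (Quotient.mk s '' F) =
      Prod.snd '' ({z : X × X | s z.1 z.2} ∩ Prod.fst ⁻¹' F) := by
    ext y
    constructor
    · rintro ⟨x, hx, hxy⟩
      exact ⟨(x, y), ⟨Quotient.exact hxy, hx⟩, rfl⟩
    · rintro ⟨⟨x, y'⟩, ⟨hxy, hx⟩, rfl⟩
      exact ⟨x, hx, Quotient.sound hxy⟩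
  change IsClosed (Quotient.mk s ⁻¹' _)
  rw [this]
  exact isClosedMap_snd_of_compactSpace _ (hs.inter (hF.preimage continuous_fst))

/-- Two fibres are disjoint closed sets in a normal space. Closedness of the quotient map shrinks
separating neighbourhoods to saturated ones. -/
theorem t2Space_quotient_of_isClosed [CompactSpace X] [T2Space X]
    (hs : IsClosed {z : X × X | s z.1 z.2}) : T2Space (Quotient s) := by
  have hcl := isClosedMap_quotientMk hs
  have hc : Continuous (Quotient.mk s) := continuous_quotient_mk'
  have hfib : ∀ y : Quotient s, IsClosed (Quotient.mk s ⁻¹' {y}) := by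
    intro y
    obtain ⟨x, rfl⟩ := Quotient.exists_rep y
    have := (hcl {x} isClosed_singleton).preimage hc
    rwa [Set.image_singleton] at this
  refine ⟨fun a b hab => ?_⟩
  obtain ⟨U, V, hU, hV, haU, hbV, hUV⟩ := normal_separation (hfib a) (hfib b)
    (Disjoint.preimage _ (Set.disjoint_singleton.2 hab))
  refine ⟨_, _, isClosedMap_iff_kernImage.1 hcl hU, isClosedMap_iff_kernImage.1 hcl hV,
    fun x hx => haU hx, fun x hx => hbV hx, Set.disjoint_left.2 fun y hy hy' => ?_⟩
  obtain ⟨x, rfl⟩ := Quotient.exists_rep y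
  exact Set.disjoint_left.1 hUV (hy rfl) (hy' rfl)

/-- Fibres are compact, so each has a neighbourhood that is a finite union of basic sets inside a
given open preimage. The sets of points whose whole fibre lies in such a union form a countable
basis. -/
theorem secondCountableTopology_quotient_of_isClosed [CompactSpace X] [T2Space X]
    [SecondCountableTopology X] (hs : IsClosed {z : X × X | s z.1 z.2}) :
    SecondCountableTopology (Quotient s) := by
  have := t2Space_quotient_of_isClosed hs
  have hcl := isClosedMap_quotientMk hs
  have hc : Continuous (Quotient.mk s) := continuous_quotient_mk'
  let B := TopologicalSpace.countableBasis X
  have hB := TopologicalSpace.isBasis_countableBasis X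
  let S : Set (Set (Quotient s)) :=
    (fun F : Set (Set X) => Set.kernImage (Quotient.mk s) (⋃₀ F)) '' {F | F.Finite ∧ F ⊆ B}
  have hS : TopologicalSpace.IsTopologicalBasis S := by
    refine TopologicalSpace.isTopologicalBasis_of_isOpen_of_nhds ?_ ?_
    · rintro _ ⟨F, ⟨_, hF⟩, rfl⟩
      exact isClosedMap_iff_kernImage.1 hcl (isOpen_sUnion fun t ht => hB.isOpen (hF ht))
    · intro y W hy hW
      have hK : IsCompact (Quotient.mk s ⁻¹' {y}) := (isClosed_singleton.preimage hc).isCompact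
      obtain ⟨F, hF, hFB, hKF, hFW⟩ : ∃ F : Set (Set X), F.Finite ∧ F ⊆ B ∧
          Quotient.mk s ⁻¹' {y} ⊆ ⋃₀ F ∧ ⋃₀ F ⊆ Quotient.mk s ⁻¹' W := by
        refine hK.induction_on (p := fun K => ∃ F : Set (Set X), F.Finite ∧ F ⊆ B ∧
          K ⊆ ⋃₀ F ∧ ⋃₀ F ⊆ Quotient.mk s ⁻¹' W) ?_ ?_ ?_ ?_
        · exact ⟨∅, Set.finite_empty, by simp, by simp, by simp⟩
        · rintro K K' hKK' ⟨F, h1, h2, h3, h4⟩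
          exact ⟨F, h1, h2, hKK'.trans h3, h4⟩
        · rintro K K' ⟨F, h1, h2, h3, h4⟩ ⟨F', h1', h2', h3', h4'⟩
          refine ⟨F ∪ F', h1.union h1', Set.union_subset h2 h2', ?_, ?_⟩
          · rw [Set.sUnion_union]; exact Set.union_subset_union h3 h3'
          · rw [Set.sUnion_union]; exact Set.union_subset h4 h4'
        · intro x hx
          obtain ⟨b, hb, hxb, hbW⟩ := hB.exists_subset_of_mem_open
            (show x ∈ Quotient.mk s ⁻¹' W by rw [Set.mem_preimage, hx]; exact hy) (hW.preimage hc)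
          exact ⟨b, mem_nhdsWithin_of_mem_nhds ((hB.isOpen hb).mem_nhds hxb), {b},
            Set.finite_singleton b, by simpa using hb, by simp, by simpa using hbW⟩
      refine ⟨_, ⟨F, ⟨hF, hFB⟩, rfl⟩, fun x hx => hKF hx, fun z hz => ?_⟩
      obtain ⟨x, rfl⟩ := Quotient.exists_rep z
      exact hFW (hz rfl)
  exact hS.secondCountableTopology
    ((Set.countable_ofPred_finite_subset (TopologicalSpace.countable_countableBasis X)).image _)

end Quotient

/-! ### Collapsing the limit sets of the edge groups -/

section Collapse

universe u

variable {G : Type*} [Group G] {X : Type u} [TopologicalSpace X] [MulAction G X]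

/-- A subgroup generated by an element of infinite order. -/
def IsInfiniteCyclic (H : Subgroup G) : Prop :=
  ∃ h : G, (Function.Injective fun n : ℕ => h ^ n) ∧ Subgroup.zpowers h = H

section

variable [CompactSpace X] [T2Space X] (hX : IsConvergenceAction G X)
  (h3 : ∀ a b : X, ∃ c, c ≠ a ∧ c ≠ b)

include hX h3

theorem limitSet_finite {H : Subgroup G} (hH : IsInfiniteCyclic H) : (limitSet X H).Finite := by
  obtain ⟨h, hh, rfl⟩ := hH
  obtain ⟨σ, ξ, η, -, -, -, -, hL⟩ := exists_limitSet_zpowers hX h3 hh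
  rw [hL]
  exact Set.toFinite _

theorem limitSet_nonempty {H : Subgroup G} (hH : IsInfiniteCyclic H) :
    (limitSet X H).Nonempty := by
  obtain ⟨h, hh, rfl⟩ := hH
  obtain ⟨σ, ξ, η, -, -, -, -, hL⟩ := exists_limitSet_zpowers hX h3 hh
  rw [hL]
  exact ⟨ξ, by simp⟩

theorem smul_eq_of_mem_limitSet {H : Subgroup G} (hH : IsInfiniteCyclic H) {x : X}
    (hx : x ∈ limitSet X H) {k : G} (hk : k ∈ H) : k • x = x := by
  obtain ⟨h, hh, rfl⟩ := hH
  obtain ⟨σ, ξ, η, -, -, hξ, hη, hL⟩ := exists_limitSet_zpowers hX h3 hh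
  rw [hL] at hx
  have : h ∈ MulAction.stabilizer G x := by
    rcases hx with rfl | rfl
    · exact hξ
    · exact hη
  exact Subgroup.zpowers_le.2 this hk

/-- For `h` in `H`, the conjugate `g * h * g⁻¹` fixes `g • x`, a point of the limit set of `K`, so
malnormality puts it in `K`. Thus `g` carries the whole limit set of `H` into that of `K`, and
translates that meet are nested. -/
theorem smul_mem_limitSet_of_mem {H K : Subgroup G} (hH : IsInfiniteCyclic H)
    (hK : IsDynamicallyMalnormal X K) {g : G} {x y : X} (hx : x ∈ limitSet X H)
    (hgx : g • x ∈ limitSet X K) (hy : y ∈ limitSet X H) : g • y ∈ limitSet X K := by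
  have := hX.continuous_smul
  refine smul_mem_limitSet (fun h hh => ?_) hy
  by_contra hcon
  refine Set.disjoint_left.1 (hK _ hcon) ⟨g • x, hgx, rfl⟩ ?_
  simpa only [mul_smul, inv_smul_smul, smul_eq_of_mem_limitSet hX h3 hH hx hh] using hgx

end

variable {ι : Type*} (H : ι → Subgroup G)

variable (X) in
/-- Two points are identified if they lie in a common translate of one of the limit sets. -/
def CollapseRel (x y : X) : Prop :=
  x = y ∨ ∃ (i : ι) (g : G), g • x ∈ limitSet X (H i) ∧ g • y ∈ limitSet X (H i)

variable [CompactSpace X] [TopologicalSpace.MetrizableSpace X] (hX : IsConvergenceAction G X)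
  (h3 : ∀ a b : X, ∃ c, c ≠ a ∧ c ≠ b) (hcyc : ∀ i, IsInfiniteCyclic (H i))
  (hmal : ∀ i, IsDynamicallyMalnormal X (H i))

include hX h3 hcyc hmal

theorem CollapseRel.trans {x y z : X} (hxy : CollapseRel X H x y) (hyz : CollapseRel X H y z) :
    CollapseRel X H x z := by
  rcases hxy with rfl | ⟨i, g, hx, hy⟩
  · exact hyz
  rcases hyz with rfl | ⟨j, k, hy', hz⟩
  · exact Or.inr ⟨i, g, hx, hy⟩
  refine Or.inr ⟨j, k, ?_, hz⟩
  have := smul_mem_limitSet_of_mem hX h3 (hcyc i) (hmal j) (g := k * g⁻¹) hy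
    (by rwa [smul_smul, inv_mul_cancel_right]) hx
  rwa [smul_smul, inv_mul_cancel_right] at this

/-- The translates of the limit sets form a null family: a sequence of distinct translates of one
limit set accumulates, along a subsequence, at a single point. -/
theorem isClosed_collapseRel [Finite ι] : IsClosed {z : X × X | CollapseRel X H z.1 z.2} := by
  have := hX.continuous_smul
  refine IsSeqClosed.isClosed fun z w hz hzw => ?_
  obtain ⟨x, y⟩ := w
  have hx : Tendsto (fun n => (z n).1) atTop (𝓝 x) := (continuous_fst.tendsto _).comp hzw
  have hy : Tendsto (fun n => (z n).2) atTop (𝓝 y) := (continuous_snd.tendsto _).comp hzw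
  change CollapseRel X H x y
  by_cases hfr : ∃ᶠ n in atTop, (z n).1 = (z n).2
  · left
    obtain ⟨σ, hσ, he⟩ := extraction_of_frequently_atTop hfr
    refine tendsto_nhds_unique (hx.comp hσ.tendsto_atTop) ?_
    simpa only [Function.comp_def, he] using hy.comp hσ.tendsto_atTop
  rw [not_frequently] at hfr
  obtain ⟨σ₀, hσ₀, hne⟩ := extraction_of_frequently_atTop hfr.frequently
  have hz' : ∀ n, ∃ (i : ι) (g : G), g • (z (σ₀ n)).1 ∈ limitSet X (H i) ∧
      g • (z (σ₀ n)).2 ∈ limitSet X (H i) := fun n => (hz (σ₀ n)).resolve_left (hne n)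
  choose i g hg1 hg2 using hz'
  obtain ⟨σ₁, hσ₁, i₀, hi₀⟩ := exists_subseq_const i
  have hfin := limitSet_finite hX h3 (hcyc i₀)
  obtain ⟨h, hh, hhH⟩ := hcyc i₀
  obtain ⟨σ₂, hσ₂, hconst | hinj⟩ :=
    exists_subseq_const_or_injective fun n => (((g (σ₁ n))⁻¹ : G) : G ⧸ H i₀)
  -- Constant coset: elements of `H i₀` fix its limit set pointwise, so all pairs lie in one finite
  -- translate, which is closed.
  · refine Or.inr ⟨i₀, g (σ₁ (σ₂ 0)), ?_⟩
    have key : ∀ {u : ℕ → X} {a : X}, Tendsto u atTop (𝓝 a) →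
        (∀ n, g n • u (σ₀ n) ∈ limitSet X (H (i n))) →
        g (σ₁ (σ₂ 0)) • a ∈ limitSet X (H i₀) := by
      intro u a hu hmem
      have hsub := ((((continuous_const_smul (g (σ₁ (σ₂ 0)))).tendsto a).comp
        hu).comp (hσ₀.comp (hσ₁.comp hσ₂)).tendsto_atTop)
      refine hfin.isClosed.mem_of_tendsto hsub (Eventually.of_forall fun n => ?_)
      have h1 := hmem (σ₁ (σ₂ n))
      rw [hi₀] at h1
      have h2 : g (σ₁ (σ₂ 0)) * (g (σ₁ (σ₂ n)))⁻¹ ∈ H i₀ := by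
        have h3 := QuotientGroup.eq.1 (hconst n).symm
        simpa using h3
      have h4 := smul_eq_of_mem_limitSet hX h3 (hcyc i₀) h1 h2
      rw [smul_smul, inv_mul_cancel_right] at h4
      simp only [Function.comp]
      rw [h4]
      exact h1
    exact ⟨key hx hg1, key hy hg2⟩
  -- Distinct cosets: both coordinates tend to the attracting point `ξ` of the inverses. Only a
  -- limit point that is itself the repelling point could escape, and non-conicality excludes this.
  · left
    have hinj' : Function.Injective fun n => (g (σ₁ (σ₂ n)))⁻¹ := fun m n hmn =>
      hinj (congrArg (fun t : G => (t : G ⧸ H i₀)) hmn)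
    obtain ⟨τ, hτ, ξ, η, hc⟩ := hX.exists_subseq _ hinj'
    have key : ∀ {u : ℕ → X} {a : X}, Tendsto u atTop (𝓝 a) →
        (∀ n, g n • u (σ₀ n) ∈ limitSet X (H (i n))) → a = ξ := by
      intro u a hu hmem
      have hfin' : Finite (limitSet X (H i₀)) := hfin
      have hmem' : ∀ n, g (σ₁ (σ₂ (τ n))) • u (σ₀ (σ₁ (σ₂ (τ n)))) ∈ limitSet X (H i₀) := fun n => by
        have := hmem (σ₁ (σ₂ (τ n)))
        rwa [hi₀] at this
      obtain ⟨ρ, hρ, ⟨l, hlmem⟩, hl⟩ := exists_subseq_const fun n =>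
        (⟨_, hmem' n⟩ : limitSet X (H i₀))
      have hl' : ∀ n, u (σ₀ (σ₁ (σ₂ (τ (ρ n))))) = (g (σ₁ (σ₂ (τ (ρ n)))))⁻¹ • l := by
        intro n
        rw [eq_inv_smul_iff]
        exact congrArg Subtype.val (hl n)
      have hu' := hu.comp (hσ₀.comp (hσ₁.comp (hσ₂.comp (hτ.comp hρ)))).tendsto_atTop
      simp only [Function.comp_def, hl'] at hu'
      have hcρ := hc.comp hρ
      by_cases hlη : l = η
      · have hmal' := hmal i₀
        rw [← hhH] at hmal' hlmem
        rw [← hlη] at hcρ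
        refine eq_of_tendsto_of_distinct_cosets hX h3 hh hmal' hlmem ?_ hcρ hu'
        intro m n hmn
        rw [hhH] at hmn
        exact (hτ.comp hρ).injective (hinj (QuotientGroup.eq.2 hmn))
      · exact tendsto_nhds_unique hu' (hcρ.tendsto_const hlη)
    exact (key hx hg1).trans (key hy hg2).symm

theorem exists_collapse [Finite ι] :
    ∃ (X' : Type u) (_ : TopologicalSpace X') (_ : CompactSpace X')
      (_ : TopologicalSpace.MetrizableSpace X') (_ : MulAction G X') (π : X → X'),
      Continuous π ∧ Function.Surjective π ∧ (∀ (g : G) (x : X), π (g • x) = g • π x) ∧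
      ContinuousConstSMul G X' ∧ ∀ x y, π x = π y ↔ CollapseRel X H x y := by
  have := hX.continuous_smul
  let s : Setoid X :=
    { r := CollapseRel X H
      iseqv := ⟨fun x => Or.inl rfl,
        fun {x y} h => h.elim (fun e => Or.inl e.symm) fun ⟨i, g, h1, h2⟩ => Or.inr ⟨i, g, h2, h1⟩,
        fun h h' => CollapseRel.trans H hX h3 hcyc hmal h h'⟩ }
  have hs : IsClosed {z : X × X | s z.1 z.2} := isClosed_collapseRel H hX h3 hcyc hmal
  have hT2 := t2Space_quotient_of_isClosed hs
  have hsc := secondCountableTopology_quotient_of_isClosed hs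
  have hsmul : ∀ (g : G) (x y : X), s x y → s (g • x) (g • y) := by
    rintro g x y (rfl | ⟨i, k, h1, h2⟩)
    · exact Or.inl rfl
    · exact Or.inr ⟨i, k * g⁻¹, by simpa [mul_smul] using h1, by simpa [mul_smul] using h2⟩
  let act : MulAction G (Quotient s) :=
    { smul := fun g => Quotient.map (fun x => g • x) (hsmul g)
      one_smul := by
        rintro ⟨x⟩
        exact congrArg (Quotient.mk s) (one_smul G x)
      mul_smul := by
        rintro a b ⟨x⟩
        exact congrArg (Quotient.mk s) (mul_smul a b x) }
  refine ⟨Quotient s, inferInstance, inferInstance, inferInstance, act, Quotient.mk s,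
    continuous_quotient_mk', Quotient.mk_surjective, fun _ _ => rfl,
    ⟨fun g => continuous_quot_lift _ (continuous_quotient_mk'.comp (continuous_const_smul g))⟩,
    fun x y => ?_⟩
  exact ⟨fun h => Quotient.exact h, fun h => Quotient.sound (s := s) h⟩

end Collapse

/-! ### Equivariant quotients and non-conical points -/

section Pushforward

variable {G : Type*} [Group G] {X X' : Type*} [TopologicalSpace X] [MulAction G X]
  [TopologicalSpace X'] [MulAction G X'] {π : X → X'}

theorem ConvergesOff.map [CompactSpace X] [T2Space X'] (hc : Continuous π)
    (hs : Function.Surjective π) (hπ : ∀ (g : G) (x : X), π (g • x) = g • π x) {g : ℕ → G}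
    {ξ η : X} (h : ConvergesOff g ξ η) : ConvergesOff g (π ξ) (π η) := by
  intro K hK hη U hU
  filter_upwards [h (π ⁻¹' K) (hK.isClosed.preimage hc).isCompact hη (π ⁻¹' U)
    (hc.continuousAt.preimage_mem_nhds hU)] with n hn x hx
  obtain ⟨x, rfl⟩ := hs x
  rw [← hπ]
  exact hn x hx

theorem IsConvergenceAction.map [CompactSpace X] [T2Space X'] (hX : IsConvergenceAction G X)
    [ContinuousConstSMul G X'] (hc : Continuous π)
    (hs : Function.Surjective π) (hπ : ∀ (g : G) (x : X), π (g • x) = g • π x) :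
    IsConvergenceAction G X' where
  nonempty := hX.nonempty.map π
  continuous_smul := inferInstance
  exists_subseq g hg := by
    obtain ⟨σ, hσ, ξ, η, h⟩ := hX.exists_subseq g hg
    exact ⟨σ, hσ, _, _, h.map hc hs hπ⟩

end Pushforward

/-- A point `p` is non-conical if `g n • p → q` forces `q = ξ` whenever the distinct elements
`g n` converge to `ξ` off `p`. -/
def IsNonconical (G : Type*) [Group G] {X : Type*} [TopologicalSpace X] [MulAction G X]
    (p : X) : Prop :=
  ∀ (g : ℕ → G), Function.Injective g → ∀ ξ q : X, ConvergesOff g ξ p →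
    Tendsto (fun n => g n • p) atTop (𝓝 q) → q = ξ

theorem IsNonconical.smul {G : Type*} [Group G] {X : Type*} [TopologicalSpace X] [MulAction G X]
    [ContinuousConstSMul G X] {p : X} (hp : IsNonconical G p) (a : G) :
    IsNonconical G (a • p) := by
  intro g hg ξ q hc hq
  refine hp (fun n => g n * a) (fun m n hmn => hg (mul_right_cancel hmn)) ξ q ?_ ?_
  · simpa using hc.mul_right a
  · simpa only [mul_smul] using hq

section Nonconical

variable {G : Type*} [Group G] {X X' : Type*} [TopologicalSpace X] [MulAction G X]
  [TopologicalSpace X'] [MulAction G X'] {π : X → X'}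
  [CompactSpace X] [TopologicalSpace.MetrizableSpace X] (hX : IsConvergenceAction G X)
  (h3 : ∀ a b : X, ∃ c, c ≠ a ∧ c ≠ b)
  [CompactSpace X'] [TopologicalSpace.MetrizableSpace X']
  (hc : Continuous π) (hs : Function.Surjective π) (hπ : ∀ (g : G) (x : X), π (g • x) = g • π x)

include hX h3 hc hs hπ

/-- Lift the convergence to `X`; the repelling point lies in the limit set of `H`. Any second point
of this limit set is attracted to `ξ'` and, after collapsing, carries `p` along. If there is no
second point, either the coset of `H` is constant on a subsequence and `ξ'` is the corresponding
translate of that point, or the cosets are distinct and `eq_of_tendsto_of_distinct_cosets` applies.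
-/
theorem isNonconical_of_collapse (h3' : ∀ a b : X', ∃ c, c ≠ a ∧ c ≠ b) {H : Subgroup G}
    (hH : IsInfiniteCyclic H) (hmal : IsDynamicallyMalnormal X H) {p : X'}
    (hp : ∀ x, π x = p ↔ x ∈ limitSet X H) : IsNonconical G p := by
  have := hX.continuous_smul
  intro a ha ξ q hap hq
  obtain ⟨σ, hσ, ξ', η', hconv⟩ := hX.exists_subseq a ha
  obtain ⟨rfl, hη⟩ := (hap.comp hσ).unique h3' (hconv.map hc hs hπ)
  have hη' : η' ∈ limitSet X H := (hp η').1 hη.symm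
  by_cases hex : ∃ l ∈ limitSet X H, l ≠ η'
  · obtain ⟨l, hl, hlη⟩ := hex
    have h1 := (hc.tendsto ξ').comp (hconv.tendsto_const hlη)
    simp only [Function.comp_def, hπ, (hp l).2 hl] at h1
    exact tendsto_nhds_unique (hq.comp hσ.tendsto_atTop) h1
  push Not at hex
  obtain ⟨τ, hτ, hconst | hinj⟩ :=
    exists_subseq_const_or_injective fun n => ((a (σ n) : G) : G ⧸ H)
  · have hmem : ∀ n, (a (σ (τ 0)))⁻¹ * a (σ (τ n)) ∈ H := fun n => QuotientGroup.eq.1 (hconst n).symm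
    have h1 := (hconv.comp hτ).mul_left (a (σ (τ 0)))⁻¹
    have h2 : (a (σ (τ 0)))⁻¹ • ξ' ∈ limitSet X H :=
      ⟨_, fun m n hmn => hτ.injective (hσ.injective (ha (mul_left_cancel hmn))), hmem, _, h1⟩
    have h4 : ξ' = a (σ (τ 0)) • η' := by rw [← hex _ h2, smul_inv_smul]
    refine tendsto_nhds_unique ((hq.comp hσ.tendsto_atTop).comp hτ.tendsto_atTop) ?_
    rw [h4, hπ, ← hη]
    refine tendsto_const_nhds.congr fun n => ?_
    have h5 : (a (σ (τ 0)))⁻¹ • a (σ (τ n)) • p = p := by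
      rw [hη, smul_smul, ← hπ, smul_eq_of_mem_limitSet hX h3 hH hη' (hmem n)]
    simp only [Function.comp]
    rw [inv_smul_eq_iff] at h5
    exact h5.symm
  · obtain ⟨ζ, ρ, hρ, hζ⟩ := CompactSpace.tendsto_subseq fun n => a (σ (τ n)) • η'
    have hζq : q = π ζ := by
      refine tendsto_nhds_unique (((hq.comp hσ.tendsto_atTop).comp hτ.tendsto_atTop).comp
        hρ.tendsto_atTop) (((hc.tendsto ζ).comp hζ).congr fun n => ?_)
      simp only [Function.comp]
      rw [hπ, hη]
    rw [hζq]
    congr 1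
    obtain ⟨h, hh, rfl⟩ := hH
    refine eq_of_tendsto_of_distinct_cosets hX h3 hh hmal hη' ?_ ((hconv.comp hτ).comp hρ) hζ
    intro m n hmn
    exact hρ.injective (hinj (QuotientGroup.eq.2 hmn))

end Nonconical

/-! ### Infinite limit sets -/

section LimitPoints

variable {G : Type*} [Group G] {X : Type*} [TopologicalSpace X] [MulAction G X]

/-- The limit set is invariant. Were it finite, infinitely many distinct elements would act
identically on three of its points, contrary to `IsConvergenceAction.not_three`. -/
theorem limitSet_top_infinite [CompactSpace X] [T2Space X] (hX : IsConvergenceAction G X)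
    (hne : IsNonElementary G X) : (limitSet X (⊤ : Subgroup G)).Infinite := by
  have := hX.continuous_smul
  intro hfin
  have hfin' : Finite (limitSet X (⊤ : Subgroup G)) := hfin
  obtain ⟨s, hs, hs3⟩ := Set.exists_subset_encard_eq hne
  obtain ⟨x, y, z, hxy, hxz, hyz, rfl⟩ := Set.encard_eq_three.1 hs3
  obtain ⟨g, hg, -⟩ := hs (Set.mem_insert x _)
  have hmem : ∀ n (u : ({x, y, z} : Set X)), g n • (u : X) ∈ limitSet X (⊤ : Subgroup G) :=
    fun n u => smul_mem_limitSet (fun _ _ => Subgroup.mem_top _) (hs u.2)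
  obtain ⟨σ, hσ, w, hw⟩ := exists_subseq_const fun n =>
    (fun u => ⟨_, hmem n u⟩ : ({x, y, z} : Set X) → limitSet X (⊤ : Subgroup G))
  have hconst : ∀ (u : ({x, y, z} : Set X)),
      Tendsto (fun n => g (σ n) • (u : X)) atTop (𝓝 (w u)) := by
    intro u
    refine tendsto_const_nhds.congr fun n => ?_
    rw [← hw n]
  have hinj : ∀ u v : ({x, y, z} : Set X), (u : X) ≠ v → (w u : X) ≠ w v := by
    intro u v huv he
    rw [← hw 0] at he
    exact huv (MulAction.injective _ he)
  let x' : ({x, y, z} : Set X) := ⟨x, by simp⟩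
  let y' : ({x, y, z} : Set X) := ⟨y, by simp⟩
  let z' : ({x, y, z} : Set X) := ⟨z, by simp⟩
  exact hX.not_three (hg.comp hσ.injective) (tendsto_const_nhds (x := x))
    (tendsto_const_nhds (x := y)) (tendsto_const_nhds (x := z)) (hconst x') (hconst y')
    (hconst z') hxy hxz hyz (hinj x' y' hxy) (hinj x' z' hxz) (hinj y' z' hyz)

theorem three_points_of_infinite {X : Type*} {s : Set X} (hs : s.Infinite) (a b : X) :
    ∃ c, c ≠ a ∧ c ≠ b := by
  obtain ⟨c, -, hc⟩ := hs.exists_notMem_finset (({a, b} : Set X).toFinite.toFinset)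
  simp only [Set.Finite.mem_toFinset, Set.mem_insert_iff, Set.mem_singleton_iff, not_or] at hc
  exact ⟨c, hc.1, hc.2⟩

end LimitPoints


theorem eventually_ne_of_tendsto {X : Type*} [TopologicalSpace X] [T2Space X] {x y : ℕ → X}
    {a b : X} (hx : Tendsto x atTop (𝓝 a)) (hy : Tendsto y atTop (𝓝 b)) (hab : a ≠ b) :
    ∀ᶠ n in atTop, x n ≠ y n :=
  (hx.prodMk_nhds hy).eventually (isClosed_diagonal.isOpen_compl.mem_nhds hab)

/-! ### The tree of spaces and its convergence action -/

section TreeSpace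

variable {Γ A X : Type*} [Group Γ] [Group A] [MulAction A X]

/-- Directions in a tree of spaces: the translates `γ • X` of `X` are indexed by the cosets of
`A` in `Γ`, and `d (γ⁻¹ * δ)` is the point of `γ • X` (pulled back to `X`) in the direction of
`δ • X`. -/
structure IsDirectionMap (j : A →* Γ) (d : Γ → X) : Prop where
  left : ∀ a γ, γ ∉ j.range → d (j a * γ) = a • d γ
  right : ∀ a γ, γ ∉ j.range → d (γ * j a) = d γ
  tri : ∀ γ γ', γ ∉ j.range → γ' ∉ j.range → γ⁻¹ * γ' ∉ j.range → d γ ≠ d γ' →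
    d (γ⁻¹ * γ') = d γ⁻¹
  finite_between : ∀ w, ∃ F : Finset Γ, ∀ δ, δ ∉ j.range → δ⁻¹ * w ∉ j.range →
    d δ⁻¹ ≠ d (δ⁻¹ * w) → ∃ φ ∈ F, φ⁻¹ * δ ∈ j.range

/-- The space of consistent families of points in the translates of `X`. -/
def treeSpace (j : A →* Γ) (d : Γ → X) : Set (Γ → X) :=
  {f | (∀ γ a, f (γ * j a) = a⁻¹ • f γ) ∧
    ∀ γ δ, γ⁻¹ * δ ∉ j.range → f γ = d (γ⁻¹ * δ) ∨ f δ = d (δ⁻¹ * γ)}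

instance treeSpace.mulAction (j : A →* Γ) (d : Γ → X) : MulAction Γ (treeSpace j d) where
  smul g f := ⟨fun γ => f.1 (g⁻¹ * γ), fun γ a => by
      rw [← f.2.1, mul_assoc],
    fun γ δ h => by
      have := f.2.2 (g⁻¹ * γ) (g⁻¹ * δ)
      simp only [mul_inv_rev, inv_inv, mul_assoc, mul_inv_cancel_left] at this
      exact this h⟩
  one_smul f := Subtype.ext (funext fun γ => by
    change f.1 (1⁻¹ * γ) = f.1 γ
    simp)
  mul_smul g h f := Subtype.ext (funext fun γ => by
    change f.1 ((g * h)⁻¹ * γ) = f.1 (h⁻¹ * (g⁻¹ * γ))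
    rw [mul_inv_rev, mul_assoc])

variable {j : A →* Γ} {d : Γ → X}

theorem treeSpace.smul_apply (g : Γ) (f : treeSpace j d) (γ : Γ) :
    (g • f).1 γ = f.1 (g⁻¹ * γ) := rfl

theorem treeSpace.hom_smul_apply_one (a : A) (f : treeSpace j d) :
    (j a • f).1 1 = a • f.1 1 := by
  have := f.2.1 1 a⁻¹
  rw [treeSpace.smul_apply, mul_one, ← map_inv, ← one_mul (j a⁻¹), this, inv_inv]

open Classical in
/-- The family of points determined by a point of the base copy of `X`. -/
noncomputable def treeSpaceFun (j : A →* Γ) (d : Γ → X) (x : X) (γ : Γ) : X :=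
  if h : γ ∈ j.range then (Classical.choose h)⁻¹ • x else d γ⁻¹

theorem treeSpaceFun_hom (hj : Function.Injective j) (x : X) (a : A) :
    treeSpaceFun j d x (j a) = a⁻¹ • x := by
  have h : j a ∈ j.range := ⟨a, rfl⟩
  rw [treeSpaceFun, dif_pos h, hj (Classical.choose_spec h)]

theorem treeSpaceFun_of_notMem (x : X) {γ : Γ} (hγ : γ ∉ j.range) :
    treeSpaceFun j d x γ = d γ⁻¹ := dif_neg hγ

theorem mul_hom_mem_iff {γ : Γ} {a : A} : γ * j a ∈ j.range ↔ γ ∈ j.range :=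
  Subgroup.mul_mem_cancel_right _ ⟨a, rfl⟩

theorem hom_mul_mem_iff {γ : Γ} {a : A} : j a * γ ∈ j.range ↔ γ ∈ j.range :=
  Subgroup.mul_mem_cancel_left _ ⟨a, rfl⟩

theorem inv_mul_mem_comm {R : Subgroup Γ} {γ δ : Γ} : γ⁻¹ * δ ∈ R ↔ δ⁻¹ * γ ∈ R := by
  rw [← inv_mem_iff, mul_inv_rev, inv_inv]

section Embed

variable (hj : Function.Injective j) (D : IsDirectionMap j d)

include hj D

/-- Away from the base copy the family points back to it. For two translates off the base, `tri`
says that if the first sees the second and the base in different directions, then the second sees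
the first and the base in the same direction. -/
theorem treeSpaceFun_mem (x : X) : treeSpaceFun j d x ∈ treeSpace j d := by
  constructor
  · intro γ a
    by_cases hγ : γ ∈ j.range
    · obtain ⟨b, rfl⟩ := hγ
      rw [← map_mul, treeSpaceFun_hom hj, treeSpaceFun_hom hj, mul_inv_rev, mul_smul]
    · rw [treeSpaceFun_of_notMem _ hγ, treeSpaceFun_of_notMem _ (mul_hom_mem_iff.not.2 hγ),
        mul_inv_rev, ← map_inv, D.left _ _ (inv_mem_iff.not.2 hγ)]
  · intro γ δ h
    by_cases hγ : γ ∈ j.range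
    · obtain ⟨a, rfl⟩ := hγ
      rw [← map_inv, hom_mul_mem_iff] at h
      right
      rw [treeSpaceFun_of_notMem _ h, D.right _ _ (inv_mem_iff.not.2 h)]
    · rw [treeSpaceFun_of_notMem _ hγ]
      by_cases hδ : δ ∈ j.range
      · obtain ⟨a, rfl⟩ := hδ
        left
        rw [D.right _ _ (inv_mem_iff.not.2 hγ)]
      · rw [treeSpaceFun_of_notMem _ hδ, or_iff_not_imp_left]
        intro hne
        have := D.tri (γ⁻¹ * δ) γ⁻¹ h (inv_mem_iff.not.2 hγ)
          (by simpa using inv_mem_iff.not.2 hδ) (Ne.symm hne)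
        simpa using this

/-- The embedding of the base copy of `X` into the space of consistent families. -/
noncomputable def treeSpaceEmbed (x : X) : treeSpace j d :=
  ⟨treeSpaceFun j d x, treeSpaceFun_mem hj D x⟩

theorem treeSpaceEmbed_hom (x : X) (a : A) : (treeSpaceEmbed hj D x).1 (j a) = a⁻¹ • x :=
  treeSpaceFun_hom hj x a

theorem treeSpaceEmbed_one (x : X) : (treeSpaceEmbed hj D x).1 1 = x := by
  simpa using treeSpaceEmbed_hom hj D x 1

theorem treeSpaceEmbed_of_notMem (x : X) {γ : Γ} (hγ : γ ∉ j.range) :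
    (treeSpaceEmbed hj D x).1 γ = d γ⁻¹ := dif_neg hγ

theorem treeSpaceEmbed_injective : Function.Injective (treeSpaceEmbed hj D) := fun x y h => by
  rw [← treeSpaceEmbed_one hj D x, h, treeSpaceEmbed_one]

theorem exists_ne_of_ne_embed {f : treeSpace j d} {x : X} (h : f ≠ treeSpaceEmbed hj D x) :
    f.1 1 ≠ x ∨ ∃ v, v ∉ j.range ∧ f.1 v ≠ d v⁻¹ := by
  by_contra! hcon
  refine h (Subtype.ext (funext fun γ => ?_))
  by_cases hγ : γ ∈ j.range
  · obtain ⟨a, rfl⟩ := hγ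
    rw [treeSpaceEmbed_hom, ← hcon.1, ← f.2.1, one_mul]
  · rw [hcon.2 γ hγ, treeSpaceEmbed_of_notMem _ _ _ hγ]

end Embed

/-- A family that does not point from `v` back to the base copy has to be seen from the base in the
direction of `v`. -/
theorem treeSpace.apply_one_eq {f : treeSpace j d} {v : Γ} (hv : v ∉ j.range) (h : f.1 v ≠ d v⁻¹) :
    f.1 1 = d v := by
  have := f.2.2 1 v (by simpa using hv)
  simp only [inv_one, one_mul, mul_one] at this
  exact this.resolve_right h

variable [TopologicalSpace X]

theorem isClosed_treeSpace [T2Space X] [ContinuousConstSMul A X] :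
    IsClosed (treeSpace j d) := by
  have : treeSpace j d = (⋂ (γ : Γ) (a : A), {f | f (γ * j a) = a⁻¹ • f γ}) ∩
      ⋂ (γ : Γ) (δ : Γ) (_ : γ⁻¹ * δ ∉ j.range),
        ({f | f γ = d (γ⁻¹ * δ)} ∪ {f | f δ = d (δ⁻¹ * γ)}) := by
    ext f
    simp [treeSpace]
  rw [this]
  refine IsClosed.inter (isClosed_iInter fun γ => isClosed_iInter fun a => ?_)
    (isClosed_iInter fun γ => isClosed_iInter fun δ => isClosed_iInter fun _ => ?_)
  · exact isClosed_eq (continuous_apply _) ((continuous_apply γ).const_smul _)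
  · exact (isClosed_eq (continuous_apply _) continuous_const).union
      (isClosed_eq (continuous_apply _) continuous_const)

instance treeSpace.continuousConstSMul : ContinuousConstSMul Γ (treeSpace j d) :=
  ⟨fun g => continuous_induced_rng.2
    (continuous_pi fun γ => (continuous_apply (g⁻¹ * γ)).comp continuous_subtype_val)⟩

theorem treeSpace.tendsto_apply {f : ℕ → treeSpace j d} {g : treeSpace j d}
    (h : Tendsto f atTop (𝓝 g)) (γ : Γ) : Tendsto (fun n => (f n).1 γ) atTop (𝓝 (g.1 γ)) :=
  (((continuous_apply γ).comp continuous_subtype_val).tendsto g).comp h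

theorem treeSpace.eventually_ne [T2Space X] {f : ℕ → treeSpace j d} {g : treeSpace j d}
    (h : Tendsto f atTop (𝓝 g)) {γ : Γ} {x : X} (hx : g.1 γ ≠ x) :
    ∀ᶠ n in atTop, (f n).1 γ ≠ x :=
  (treeSpace.tendsto_apply h γ).eventually_ne hx

/-- A fixed point is the repelling or the attracting point of any limit pair. Non-conicality,
applied to the sequence or to its inverses, makes the two coincide: the elements act as parabolics
at `p`. -/
theorem IsNonconical.exists_subseq_of_fixed [CompactSpace X] [T2Space X]
    (hX : IsConvergenceAction A X) {p : X} (hp : IsNonconical A p) {b : ℕ → A}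
    (hb : Function.Injective b) (hfix : ∀ n, b n • p = p) :
    ∃ σ : ℕ → ℕ, StrictMono σ ∧ ConvergesOff (b ∘ σ) p p := by
  obtain ⟨σ, hσ, ξ, η, hc⟩ := hX.exists_subseq b hb
  have hbσ := hb.comp hσ.injective
  have ht : Tendsto (fun n => (b ∘ σ) n • p) atTop (𝓝 p) := by
    simp only [Function.comp_apply, hfix]
    exact tendsto_const_nhds
  by_cases hη : p = η
  · subst hη
    have := hp _ hbσ ξ p hc ht
    exact ⟨σ, hσ, this ▸ hc⟩
  · have hξ : p = ξ := tendsto_nhds_unique ht (hc.tendsto_const hη)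
    subst hξ
    refine absurd (hp _ (inv_injective.comp hbσ) η p hc.inv ?_) hη
    have : ∀ n, (Inv.inv ∘ b ∘ σ) n • p = p := fun n => by
      simp only [Function.comp_apply]
      rw [inv_smul_eq_iff, hfix]
    simp only [this]
    exact tendsto_const_nhds

variable [CompactSpace X] [TopologicalSpace.MetrizableSpace X] (hX : IsConvergenceAction A X)
  (hj : Function.Injective j) (D : IsDirectionMap j d)

include hX hj D

/-- The limits are read off from the forward and backward orbits of one base point `m`. If `k n` and
its image differ from these orbits at coordinates `v` and `w`, consistency of `k n` at `v` and `g⁻¹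
* w` forces `g * v` to separate the base from `w`, or `g⁻¹ * w` to separate it from `v`. By
`finite_between` only finitely many cosets separate, and the sequence leaves them all. -/
theorem treeSpace.convergesOff_of_escaping [Countable Γ] {γ : ℕ → Γ}
    (hesc : ∀ u w, ∀ᶠ n in atTop, w⁻¹ * (γ n * u) ∉ j.range) :
    ∃ σ : ℕ → ℕ, StrictMono σ ∧ ∃ ξ η : treeSpace j d, ConvergesOff (γ ∘ σ) ξ η := by
  have := hX.continuous_smul
  have : CompactSpace (treeSpace j d) := isCompact_iff_compactSpace.1 isClosed_treeSpace.isCompact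
  obtain ⟨x₀⟩ := hX.nonempty
  set m := treeSpaceEmbed hj D x₀ with hm
  obtain ⟨ξ, σ, hσ, hξ⟩ := CompactSpace.tendsto_subseq fun n => γ n • m
  obtain ⟨η, τ, hτ, hη⟩ := CompactSpace.tendsto_subseq fun n => (γ (σ n))⁻¹ • m
  refine ⟨σ ∘ τ, hσ.comp hτ, ξ, η, convergesOff_of_seq fun ρ hρ k k₀ y₀ hk hy hkη hyξ => ?_⟩
  replace hξ := hξ.comp (hτ.comp hρ).tendsto_atTop
  replace hη := hη.comp hρ.tendsto_atTop
  have hs : StrictMono (σ ∘ τ ∘ ρ) := hσ.comp (hτ.comp hρ)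
  set s := σ ∘ τ ∘ ρ with hsdef
  have hesc' : ∀ u w, ∀ᶠ n in atTop, w⁻¹ * (γ (s n) * u) ∉ j.range := fun u w =>
    hs.tendsto_atTop.eventually (hesc u w)
  obtain ⟨w, hw⟩ : ∃ w, y₀.1 w ≠ ξ.1 w := by
    by_contra! h
    exact hyξ (Subtype.ext (funext h))
  obtain ⟨v, hv⟩ : ∃ v, k₀.1 v ≠ η.1 v := by
    by_contra! h
    exact hkη (Subtype.ext (funext h))
  have hevw : ∀ᶠ n in atTop, (γ (s n) • k n).1 w ≠ (γ (s n) • m).1 w :=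
    eventually_ne_of_tendsto (treeSpace.tendsto_apply hy w) (treeSpace.tendsto_apply hξ w) hw
  have hevv : ∀ᶠ n in atTop, (k n).1 v ≠ ((γ (s n))⁻¹ • m).1 v :=
    eventually_ne_of_tendsto (treeSpace.tendsto_apply hk v) (treeSpace.tendsto_apply hη v) hv
  obtain ⟨F, hF⟩ := D.finite_between w
  obtain ⟨F', hF'⟩ := D.finite_between v
  have h1 : ∀ᶠ n in atTop, ∀ φ ∈ F, φ⁻¹ * (γ (s n) * v) ∉ j.range :=
    (eventually_all_finset F).2 fun φ _ => hesc' v φ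
  have h2 : ∀ᶠ n in atTop, ∀ φ ∈ F', w⁻¹ * (γ (s n) * φ) ∉ j.range :=
    (eventually_all_finset F').2 fun φ _ => hesc' φ w
  obtain ⟨n, hevw, hevv, h1, h2, h4, h5, h6⟩ := (hevw.and (hevv.and (h1.and (h2.and
    ((hesc' v w).and ((hesc' v 1).and (hesc' 1 w))))))).exists
  set g := γ (s n)
  have hgv : g * v ∉ j.range := by simpa using h5
  have hgw : g⁻¹ * w ∉ j.range := by
    have := inv_mem_iff.not.2 h6
    simpa [mul_assoc] using this
  rw [treeSpace.smul_apply, treeSpace.smul_apply, hm, treeSpaceEmbed_of_notMem hj D x₀ hgw] at hevw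
  rw [treeSpace.smul_apply, inv_inv, hm, treeSpaceEmbed_of_notMem hj D x₀ hgv] at hevv
  have hvw : v⁻¹ * (g⁻¹ * w) ∉ j.range := by
    have := inv_mem_iff.not.2 h4
    simpa [mul_assoc] using this
  rcases (k n).2.2 v (g⁻¹ * w) hvw with h | h
  · obtain ⟨φ, hφ, hφ'⟩ := hF (g * v) hgv (by simpa [mul_assoc] using hvw) (by
      rw [h] at hevv
      simpa [mul_assoc] using hevv.symm)
    exact h1 φ hφ hφ'
  · obtain ⟨φ, hφ, hφ'⟩ := hF' (g⁻¹ * w) hgw (by simpa [mul_assoc] using h4) (by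
      rw [h] at hevw
      simpa [mul_assoc] using hevw.symm)
    refine h2 φ hφ ?_
    have := inv_mem hφ'
    simpa [mul_assoc] using this

variable (hnc : ∀ γ, γ ∉ j.range → IsNonconical A (d γ))

include hnc

/-- The situation excluded: `k₀` lies beyond `v` and `y₀` beyond `w`, as seen from the base, while
infinitely often the translate of `a n * v` is that of `w` or separates it from the base. Only
finitely many such translates exist, so up to elements fixing the direction `d v⁻¹` the sequence is
constant there. These elements are parabolic at `d v⁻¹`, so they make `y₀` point back to the base.
-/
theorem treeSpace.false_of_frequently {a : ℕ → A} (ha : Function.Injective a)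
    {k : ℕ → treeSpace j d} {k₀ y₀ : treeSpace j d} (hk : Tendsto k atTop (𝓝 k₀))
    (hy : Tendsto (fun n => j (a n) • k n) atTop (𝓝 y₀)) {v w : Γ} (hv : v ∉ j.range)
    (hw : w ∉ j.range) (hkv : k₀.1 v ≠ d v⁻¹) (hyw : y₀.1 w ≠ d w⁻¹)
    (hfr : ∃ᶠ n in atTop, w⁻¹ * (j (a n) * v) ∈ j.range ∨
      (w⁻¹ * (j (a n) * v) ∉ j.range ∧ d (j (a n) * v)⁻¹ ≠ d ((j (a n) * v)⁻¹ * w))) : False := by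
  classical
  obtain ⟨F, hF⟩ := D.finite_between w
  obtain ⟨σ, hσ, hP⟩ := extraction_of_frequently_atTop hfr
  have hφ : ∀ n, ∃ φ : (insert w F : Finset Γ), (φ : Γ)⁻¹ * (j (a (σ n)) * v) ∈ j.range := by
    intro n
    rcases hP n with h | ⟨h, h'⟩
    · exact ⟨⟨w, Finset.mem_insert_self _ _⟩, h⟩
    · obtain ⟨φ, hφF, hφ⟩ := hF _ (hom_mul_mem_iff.not.2 hv) (inv_mul_mem_comm.not.1 h) h'
      exact ⟨⟨φ, Finset.mem_insert_of_mem hφF⟩, hφ⟩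
  choose φ hφ using hφ
  obtain ⟨τ, hτ, φ₀, hφ₀⟩ := exists_subseq_const φ
  set s := σ ∘ τ with hs
  have hsm : StrictMono s := hσ.comp hτ
  set v₀ := j (a (s 0)) * v with hv₀
  have hb : ∀ n, ∃ b, j b = v₀⁻¹ * (j (a (s n)) * v) := by
    intro n
    have h1 := hφ (τ 0)
    have h2 := hφ (τ n)
    rw [hφ₀] at h1 h2
    have := mul_mem (inv_mem h1) h2
    rw [mul_inv_rev, inv_inv, mul_assoc, mul_inv_cancel_left] at this
    exact this
  choose b hb using hb
  have hbinj : Function.Injective b := by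
    intro m n hmn
    have h1 := hb m
    rw [hmn, hb n] at h1
    exact hsm.injective (ha (hj (mul_right_cancel (mul_left_cancel h1)))).symm
  have hv' : v⁻¹ ∉ j.range := inv_mem_iff.not.2 hv
  have hfix : ∀ n, b n • d v⁻¹ = d v⁻¹ := by
    intro n
    rw [← D.left _ _ hv', hb, ← D.right ((a (s 0))⁻¹ * a (s n)) _ hv']
    congr 1
    simp only [hv₀, map_mul, map_inv]
    group
  obtain ⟨ρ, hρ, hc⟩ := (hnc _ hv').exists_subseq_of_fixed hX hbinj hfix
  have hlim := hc.tendsto ((treeSpace.tendsto_apply (hk.comp (hsm.comp hρ).tendsto_atTop)) v) hkv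
  have hlim' := treeSpace.tendsto_apply (hy.comp (hsm.comp hρ).tendsto_atTop) v₀
  -- At `v₀` the image family is `b n • (k n).1 v`. Since `k₀.1 v` is not the repelling point `d
  -- v⁻¹`, the limit is the attracting point, again `d v⁻¹`.
  have hyv : y₀.1 v₀ = d v⁻¹ := by
    refine tendsto_nhds_unique hlim' (hlim.congr fun n => ?_)
    simp only [Function.comp_apply]
    have h1 := (k (s (ρ n))).2.1 v (b (ρ n))⁻¹
    rw [inv_inv] at h1
    rw [← h1, treeSpace.smul_apply, map_inv, hb]
    group
  have hdv : d v₀⁻¹ = d v⁻¹ := by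
    rw [hv₀, mul_inv_rev, ← map_inv, D.right _ _ hv']
  have hv₀R : v₀ ∉ j.range := hom_mul_mem_iff.not.2 hv
  rcases hP (τ 0) with ⟨c, hc⟩ | ⟨h, h'⟩
  · change j c = w⁻¹ * v₀ at hc
    have hweq : w = v₀ * j c⁻¹ := by rw [map_inv, hc]; group
    apply hyw
    rw [hweq, y₀.2.1, hyv, mul_inv_rev, ← map_inv, D.left _ _ (inv_mem_iff.not.2 hv₀R), hdv]
  · change w⁻¹ * v₀ ∉ j.range at h
    change d v₀⁻¹ ≠ d (v₀⁻¹ * w) at h'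
    rcases y₀.2.2 v₀ w (inv_mul_mem_comm.not.1 h) with h1 | h1
    · exact h' (by rw [← h1, hyv, hdv])
    · apply hyw
      have := D.tri (v₀⁻¹ * w) v₀⁻¹ (inv_mul_mem_comm.not.1 h) (inv_mem_iff.not.2 hv₀R)
        (by simpa using inv_mem_iff.not.2 hw) (Ne.symm h')
      rw [h1]
      simpa using this.symm

/-- At the base coordinate this is the convergence in `X`. A family lying beyond another translate
shows at the base only a direction, which might be the attracting or repelling point itself;
non-conicality of directions handles these cases. -/
theorem treeSpace.convergesOff_embed [Countable Γ] {a : ℕ → A} (ha : Function.Injective a)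
    {ξ η : X} (hc : ConvergesOff a ξ η) :
    ConvergesOff (fun n => j (a n)) (treeSpaceEmbed hj D ξ) (treeSpaceEmbed hj D η) := by
  have := hX.continuous_smul
  have : CompactSpace (treeSpace j d) := isCompact_iff_compactSpace.1 isClosed_treeSpace.isCompact
  refine convergesOff_of_seq fun σ hσ k k₀ y₀ hk hy hkη hyξ => ?_
  have hc := hc.comp hσ
  have haσ : Function.Injective (a ∘ σ) := ha.comp hσ.injective
  have hk1 := treeSpace.tendsto_apply hk 1
  have hy1 := treeSpace.tendsto_apply hy 1
  simp only [treeSpace.hom_smul_apply_one] at hy1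
  have h11 : k₀.1 1 ≠ η → y₀.1 1 = ξ := fun h => tendsto_nhds_unique hy1 (hc.tendsto hk1 h)
  rcases exists_ne_of_ne_embed hj D hkη with h1 | ⟨v, hv, hkv⟩
  · rcases exists_ne_of_ne_embed hj D hyξ with h2 | ⟨w, hw, hyw⟩
    · exact h2 (h11 h1)
    · have hξ : ξ = d w := (h11 h1).symm.trans (treeSpace.apply_one_eq hw hyw)
      subst hξ
      -- The inverses converge to `η` off `d w` and take `d w` to the base coordinate of `k n`, so
      -- non-conicality of `d w` gives `k₀.1 1 = η`.
      refine h1 (hnc w hw _ (inv_injective.comp haσ) η _ hc.inv (hk1.congr' ?_))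
      filter_upwards [treeSpace.eventually_ne hy hyw] with n hn
      have := treeSpace.apply_one_eq hw hn
      rw [treeSpace.hom_smul_apply_one] at this
      simp only [Function.comp_apply]
      rw [← this, inv_smul_smul]
  · have hevk := treeSpace.eventually_ne hk hkv
    have hη : k₀.1 1 = d v := treeSpace.apply_one_eq hv hkv
    rcases exists_ne_of_ne_embed hj D hyξ with h2 | ⟨w, hw, hyw⟩
    · by_cases h1 : k₀.1 1 = η
      · rw [← h1, hη] at hc
        refine h2 (hnc v hv _ haσ ξ _ hc (hy1.congr' ?_))
        filter_upwards [hevk] with n hn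
        rw [treeSpace.apply_one_eq hv hn]
        rfl
      · exact h2 (h11 h1)
    · have hevy := treeSpace.eventually_ne hy hyw
      by_cases hfr : ∃ᶠ n in atTop, w⁻¹ * (j (a (σ n)) * v) ∈ j.range ∨
          (w⁻¹ * (j (a (σ n)) * v) ∉ j.range ∧
            d (j (a (σ n)) * v)⁻¹ ≠ d ((j (a (σ n)) * v)⁻¹ * w))
      · exact treeSpace.false_of_frequently hX hj D hnc haσ hk hy hv hw hkv hyw hfr
      rw [not_frequently] at hfr
      -- If `a n * v` does not separate the base from `w`, consistency makes the image family at `w`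
      -- point at `a n * v` and not at the base. Then `(a n)⁻¹ * w` separates the base from `v`, and
      -- the same lemma applies to the inverses.
      refine treeSpace.false_of_frequently hX hj D hnc (a := fun n => (a (σ n))⁻¹)
        (inv_injective.comp haσ) hy (y₀ := k₀) ?_ hw hv hyw hkv ?_
      · simpa only [map_inv, inv_smul_smul] using hk
      · refine Eventually.frequently ?_
        filter_upwards [hfr, hevk, hevy] with n h1 h2 h4
        right
        push Not at h1
        obtain ⟨h1, h1'⟩ := h1
        have h1' := h1' h1
        have hwR : (j (a (σ n)))⁻¹ * w ∉ j.range := by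
          rw [← map_inv]; exact hom_mul_mem_iff.not.2 hw
        have h5 := (j (a (σ n)) • k n).2.2 w (j (a (σ n)) * v) h1
        have h6 : (j (a (σ n)) • k n).1 (j (a (σ n)) * v) = (k n).1 v := by
          rw [treeSpace.smul_apply, inv_mul_cancel_left]
        have h7 : d (j (a (σ n)) * v)⁻¹ = d v⁻¹ := by
          rw [mul_inv_rev, ← map_inv, D.right _ _ (inv_mem_iff.not.2 hv)]
        have h8 : (j (a (σ n)) • k n).1 w = d (w⁻¹ * (j (a (σ n)) * v)) := by
          refine h5.resolve_right fun h => h2 ?_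
          rw [← h6, h, ← h1', h7]
        refine ⟨?_, ?_⟩
        · rw [map_inv]
          have := inv_mul_mem_comm.not.1 h1
          simpa [mul_assoc] using this
        · rw [map_inv]
          have h9 : d ((j (a (σ n)))⁻¹ * w)⁻¹ = d w⁻¹ := by
            rw [mul_inv_rev, inv_inv, D.right _ _ (inv_mem_iff.not.2 hw)]
          rw [h9]
          intro h10
          apply h4
          rw [h8, h10]
          congr 1
          group

theorem treeSpace.isConvergenceAction [Countable Γ] :
    IsConvergenceAction Γ (treeSpace j d) := by
  have := hX.continuous_smul
  have : CompactSpace (treeSpace j d) := isCompact_iff_compactSpace.1 isClosed_treeSpace.isCompact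
  refine ⟨hX.nonempty.map (treeSpaceEmbed hj D), inferInstance, fun γ hγ => ?_⟩
  by_cases hesc : ∀ u w, ∀ᶠ n in atTop, w⁻¹ * (γ n * u) ∉ j.range
  · exact treeSpace.convergesOff_of_escaping hX hj D hesc
  push Not at hesc
  obtain ⟨u, w, hfr⟩ := hesc
  obtain ⟨σ, hσ, ha⟩ := extraction_of_frequently_atTop hfr
  choose a ha using ha
  have hainj : Function.Injective a := fun m n hmn => by
    have h1 := ha m
    rw [hmn, ha n] at h1
    exact hσ.injective (hγ (mul_right_cancel (mul_left_cancel h1))).symm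
  obtain ⟨τ, hτ, ξ, η, hc⟩ := hX.exists_subseq a hainj
  have h1 := ((treeSpace.convergesOff_embed hX hj D hnc (hainj.comp hτ.injective) hc).mul_left
    w).mul_right u⁻¹
  refine ⟨σ ∘ τ, hσ.comp hτ, w • treeSpaceEmbed hj D ξ, u⁻¹⁻¹ • treeSpaceEmbed hj D η, ?_⟩
  convert h1 using 2 with n
  simp only [Function.comp_apply, ha]
  group

end TreeSpace


/-! ### Trees certified by half-spaces -/

section HalfSpaces

variable {𝓥 𝓔 Ω : Type*} {o : 𝓔 → 𝓥} {bar : 𝓔 → 𝓔} {Z : 𝓔 → Set Ω} {B : 𝓥 → Set Ω}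

/-- A connected graph with oriented edges `𝓔`, origin map `o` and edge reversal `bar`, together
with half-spaces `Z e` witnessing that the graph is a tree. -/
structure IsHalfSpaceSystem (o : 𝓔 → 𝓥) (bar : 𝓔 → 𝓔) (Z : 𝓔 → Set Ω) (B : 𝓥 → Set Ω) :
    Prop where
  bar_bar : ∀ e, bar (bar e) = e
  compl : ∀ e, Z (bar e) = (Z e)ᶜ
  disjoint : ∀ e e', o e = o e' → e ≠ e' → Disjoint (Z e) (Z e')
  nonempty : ∀ x, (B x).Nonempty
  base_disjoint : ∀ e, Disjoint (B (o e)) (Z e)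
  connected : ∀ S : Set 𝓥, S.Nonempty → (∀ e, o e ∈ S → o (bar e) ∈ S) → S = Set.univ

/-- There is a path without backtracking whose first and last edges are the given ones. -/
inductive RedPath (o : 𝓔 → 𝓥) (bar : 𝓔 → 𝓔) : 𝓔 → 𝓔 → Prop
  | single (e : 𝓔) : RedPath o bar e e
  | snoc {e f g : 𝓔} : RedPath o bar e f → o g = o (bar f) → g ≠ bar f → RedPath o bar e g

/-- The edge `e` issues from `u` and the vertex `v` lies beyond it. -/
def IsFirstEdge (o : 𝓔 → 𝓥) (Z : 𝓔 → Set Ω) (B : 𝓥 → Set Ω) (u v : 𝓥) (e : 𝓔) : Prop :=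
  o e = u ∧ B v ⊆ Z e

theorem RedPath.cons {e f g : 𝓔} (h : RedPath o bar f g) (ho : o f = o (bar e))
    (hne : f ≠ bar e) : RedPath o bar e g := by
  induction h with
  | single => exact .snoc (.single e) ho hne
  | snoc _ h1 h2 ih => exact .snoc ih h1 h2

theorem RedPath.origin_last {e f : 𝓔} (h : RedPath o bar e f) :
    o f = o e ∨ ∃ f', RedPath o bar e f' ∧ o (bar f') = o f := by
  cases h with
  | single => exact Or.inl rfl
  | snoc h h1 h2 => exact Or.inr ⟨_, h, h1.symm⟩

variable (S : IsHalfSpaceSystem o bar Z B)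

include S

theorem RedPath.reverse {e f : 𝓔} (h : RedPath o bar e f) : RedPath o bar (bar f) (bar e) := by
  induction h with
  | single => exact .single _
  | snoc _ h1 h2 ih =>
    refine ih.cons (by rw [S.bar_bar, h1]) (fun h => h2 ?_)
    rw [h, S.bar_bar]

/-- Without backtracking, the next edge and the reverse of the last one are distinct edges at a
common origin, so their half-spaces are disjoint; as reversal is complementation, half-spaces shrink
along the path. -/
theorem RedPath.subset {e f : 𝓔} (h : RedPath o bar e f) : Z f ⊆ Z e := by
  induction h with
  | single => exact subset_rfl
  | snoc _ h1 h2 ih =>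
    refine Set.Subset.trans ?_ ih
    have := (S.disjoint _ _ h1 h2).subset_compl_right
    rwa [S.compl, compl_compl] at this

theorem RedPath.base_subset {e f : 𝓔} (h : RedPath o bar e f) : B (o (bar f)) ⊆ Z e := by
  refine Set.Subset.trans ?_ (h.subset S)
  have := (S.base_disjoint (bar f)).subset_compl_right
  rwa [S.compl, compl_compl] at this

/-- The vertices reachable by reduced paths are closed under adjacency: a backtracking edge just
deletes the last step. -/
theorem exists_redPath {u v : 𝓥} (huv : u ≠ v) :
    ∃ e f, o e = u ∧ o (bar f) = v ∧ RedPath o bar e f := by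
  have key := S.connected {v | v = u ∨ ∃ e f, o e = u ∧ o (bar f) = v ∧ RedPath o bar e f}
    ⟨u, Or.inl rfl⟩ (by
      rintro g (hg | ⟨e, f, he, hf, h⟩)
      · exact Or.inr ⟨g, g, hg, rfl, .single g⟩
      · by_cases hgf : g = bar f
        · rw [hgf, S.bar_bar]
          rcases h.origin_last with h1 | ⟨f', h1, h2⟩
          · exact Or.inl (h1.trans he)
          · exact Or.inr ⟨e, f', he, h2, h1⟩
        · exact Or.inr ⟨e, g, he, rfl, .snoc h hf.symm hgf⟩)
  have : v ∈ (Set.univ : Set 𝓥) := Set.mem_univ v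
  rw [← key] at this
  exact this.resolve_left (Ne.symm huv)

theorem IsFirstEdge.unique {u v : 𝓥} {e e' : 𝓔} (h : IsFirstEdge o Z B u v e)
    (h' : IsFirstEdge o Z B u v e') : e = e' := by
  by_contra hne
  obtain ⟨b, hb⟩ := S.nonempty v
  exact Set.disjoint_left.1 (S.disjoint e e' (h.1.trans h'.1.symm) hne) (h.2 hb) (h'.2 hb)

theorem exists_redPath_isFirstEdge {u v : 𝓥} (huv : u ≠ v) :
    ∃ e f, o (bar f) = v ∧ RedPath o bar e f ∧ IsFirstEdge o Z B u v e ∧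
      IsFirstEdge o Z B v u (bar f) := by
  obtain ⟨e, f, he, hf, h⟩ := exists_redPath S huv
  refine ⟨e, f, hf, h, ⟨he, hf ▸ h.base_subset S⟩, hf, ?_⟩
  have := (h.reverse S).base_subset S
  rwa [S.bar_bar, he] at this

theorem compl_subset_of_isFirstEdge {u v : 𝓥} (huv : u ≠ v) {e f : 𝓔}
    (he : IsFirstEdge o Z B u v e) (hf : IsFirstEdge o Z B v u f) : (Z e)ᶜ ⊆ Z f := by
  obtain ⟨e', f', -, h, he', hf'⟩ := exists_redPath_isFirstEdge S huv
  rw [he.unique S he', hf.unique S hf', S.compl]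
  exact Set.compl_subset_compl.2 (h.subset S)

theorem IsFirstEdge.tri {u v w : 𝓥} (huv : u ≠ v) {e e' f : 𝓔} (he : IsFirstEdge o Z B u v e)
    (he' : IsFirstEdge o Z B u w e') (hne : e ≠ e') (hf : IsFirstEdge o Z B v u f) :
    IsFirstEdge o Z B v w f :=
  ⟨hf.1, he'.2.trans ((S.disjoint e' e (he'.1.trans he.1.symm) hne.symm).subset_compl_right.trans
    (compl_subset_of_isFirstEdge S huv he hf))⟩

theorem IsFirstEdge.of_adj {v : 𝓥} {f g : 𝓔} (h : IsFirstEdge o Z B v (o g) f)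
    (hv : v ≠ o g) (hv' : v ≠ o (bar g)) : IsFirstEdge o Z B v (o (bar g)) f := by
  refine ⟨h.1, ?_⟩
  obtain ⟨e, f', hf', hp, he, -⟩ := exists_redPath_isFirstEdge S hv
  obtain rfl := h.unique S he
  by_cases hgf : g = bar f'
  · rw [hgf, S.bar_bar]
    rcases hp.origin_last with h1 | ⟨f'', h1, h2⟩
    · rw [hgf, S.bar_bar] at hv'
      exact absurd (h.1.symm.trans h1.symm) hv'
    · rw [← h2]
      exact h1.base_subset S
  · exact (RedPath.snoc hp hf'.symm hgf).base_subset S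

/-- Moving `w` across one edge changes the set of vertices separating `u` from `w` by at most an
endpoint of that edge, so finiteness spreads from `w = u` by connectedness. -/
theorem finite_isFirstEdge_ne (u w : 𝓥) :
    {v | v ≠ u ∧ v ≠ w ∧ ∃ f f', IsFirstEdge o Z B v u f ∧ IsFirstEdge o Z B v w f' ∧
      f ≠ f'}.Finite := by
  have key := S.connected {w | {v | v ≠ u ∧ v ≠ w ∧ ∃ f f', IsFirstEdge o Z B v u f ∧
    IsFirstEdge o Z B v w f' ∧ f ≠ f'}.Finite} ⟨u, ?_⟩ ?_
  · have : w ∈ (Set.univ : Set 𝓥) := Set.mem_univ w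
    rwa [← key] at this
  · refine Set.finite_empty.subset ?_
    rintro v ⟨-, -, f, f', h, h', hne⟩
    exact hne (h.unique S h')
  · intro e he
    refine ((show Set.Finite _ from he).insert (o e)).subset ?_
    rintro v ⟨hvu, hv, f, f', h, h', hne⟩
    by_cases hve : v = o e
    · exact Or.inl hve
    · have h1 := IsFirstEdge.of_adj S (g := bar e) h' hv (by rwa [S.bar_bar])
      rw [S.bar_bar] at h1
      exact Or.inr ⟨hvu, hve, f, f', h, h1, hne⟩

end HalfSpaces

/-! ### The Bass-Serre tree from ping-pong data -/

section PingPong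

variable {Γ V Ed Ω : Type*} [Group Γ] [MulAction Γ Ω]

/-- Ping-pong data for the vertex groups `P v`, edge groups `C ε ≤ P (s ε)` and stable letters
`x ε` of a graph of groups with oriented edges `Ed`. -/
structure IsPingPong (s : Ed → V) (bar : Ed → Ed) (P : V → Subgroup Γ) (C : Ed → Subgroup Γ)
    (x : Ed → Γ) (Z : Ed → Set Ω) (B : V → Set Ω) : Prop where
  bar_bar : ∀ ε, bar (bar ε) = ε
  le : ∀ ε, C ε ≤ P (s ε)
  letter_bar : ∀ ε, x (bar ε) = (x ε)⁻¹
  conj_mem : ∀ ε, ∀ c ∈ C ε, (x ε)⁻¹ * c * x ε ∈ C (bar ε)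
  smul_mem : ∀ ε, ∀ c ∈ C ε, ∀ ω ∈ Z ε, c • ω ∈ Z ε
  eq_of_smul_mem : ∀ ε ε', s ε = s ε' → ∀ g ∈ P (s ε), ∀ ω ∈ Z ε, g • ω ∈ Z ε' → ε = ε' ∧ g ∈ C ε
  mem_bar_iff : ∀ ε ω, ω ∈ Z (bar ε) ↔ x ε • ω ∉ Z ε
  base_smul_mem : ∀ v, ∀ g ∈ P v, ∀ ω ∈ B v, g • ω ∈ B v
  base_nonempty : ∀ v, (B v).Nonempty
  base_notMem : ∀ ε, ∀ ω ∈ B (s ε), ω ∉ Z ε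
  closure_eq : Subgroup.closure ((⋃ v, (P v : Set Γ)) ∪ Set.range x) = ⊤
  connected : ∀ S : Set V, S.Nonempty → (∀ ε, x ε = 1 → s ε ∈ S → s (bar ε) ∈ S) → S = Set.univ

variable {s : Ed → V} {bar : Ed → Ed} {P : V → Subgroup Γ} {C : Ed → Subgroup Γ}
  {x : Ed → Γ} {Z : Ed → Set Ω} {B : V → Set Ω}

namespace IsPingPong

variable (D : IsPingPong s bar P C x Z B)

/-- The origin of an edge of the Bass-Serre tree. -/
def origin (D : IsPingPong s bar P C x Z B) (e : Σ ε, Γ ⧸ C ε) : Σ v, Γ ⧸ P v :=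
  ⟨s e.1, Quotient.map' id (fun _ _ h => QuotientGroup.leftRel_apply.2
    (D.le _ (QuotientGroup.leftRel_apply.1 h))) e.2⟩

/-- Reversal of the edges of the Bass-Serre tree. -/
def reverse (D : IsPingPong s bar P C x Z B) (e : Σ ε, Γ ⧸ C ε) : Σ ε, Γ ⧸ C ε :=
  ⟨bar e.1, Quotient.map' (fun g => g * x e.1) (fun a b h => QuotientGroup.leftRel_apply.2 (by
    have := D.conj_mem _ _ (QuotientGroup.leftRel_apply.1 h)
    simpa [mul_assoc] using this)) e.2⟩

/-- The half-space of an edge of the Bass-Serre tree. -/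
def half (_ : IsPingPong s bar P C x Z B) (e : Σ ε, Γ ⧸ C ε) : Set Ω :=
  {ω | ∃ g : Γ, (g : Γ ⧸ C e.1) = e.2 ∧ g⁻¹ • ω ∈ Z e.1}

/-- The core of a vertex of the Bass-Serre tree. -/
def core (_ : IsPingPong s bar P C x Z B) (u : Σ v, Γ ⧸ P v) : Set Ω :=
  {ω | ∃ g : Γ, (g : Γ ⧸ P u.1) = u.2 ∧ g⁻¹ • ω ∈ B u.1}

theorem origin_mk (ε : Ed) (g : Γ) : D.origin ⟨ε, (g : Γ ⧸ C ε)⟩ = ⟨s ε, (g : Γ ⧸ P (s ε))⟩ := rfl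

theorem reverse_mk (ε : Ed) (g : Γ) :
    D.reverse ⟨ε, (g : Γ ⧸ C ε)⟩ = ⟨bar ε, ((g * x ε : Γ) : Γ ⧸ C (bar ε))⟩ := rfl

theorem mem_half_mk {ε : Ed} {g : Γ} {ω : Ω} :
    ω ∈ D.half ⟨ε, (g : Γ ⧸ C ε)⟩ ↔ g⁻¹ • ω ∈ Z ε := by
  constructor
  · rintro ⟨h, hh, hω⟩
    have := D.smul_mem ε _ (QuotientGroup.eq.1 hh.symm) _ hω
    rwa [smul_smul, mul_assoc, mul_inv_cancel, mul_one] at this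
  · exact fun h => ⟨g, rfl, h⟩

theorem mem_core_mk {v : V} {g : Γ} {ω : Ω} :
    ω ∈ D.core ⟨v, (g : Γ ⧸ P v)⟩ ↔ g⁻¹ • ω ∈ B v := by
  constructor
  · rintro ⟨h, hh, hω⟩
    have := D.base_smul_mem v _ (QuotientGroup.eq.1 hh.symm) _ hω
    rwa [smul_smul, mul_assoc, mul_inv_cancel, mul_one] at this
  · exact fun h => ⟨g, rfl, h⟩

theorem sigma_mk_eq_iff {ι : Type*} {H : ι → Subgroup Γ} {i i' : ι} {g g' : Γ} :
    (⟨i, (g : Γ ⧸ H i)⟩ : Σ i, Γ ⧸ H i) = ⟨i', (g' : Γ ⧸ H i')⟩ ↔ i = i' ∧ g⁻¹ * g' ∈ H i := by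
  constructor
  · intro h
    obtain rfl : i = i' := congrArg Sigma.fst h
    exact ⟨rfl, QuotientGroup.eq.1 (eq_of_heq (Sigma.mk.inj h).2)⟩
  · rintro ⟨rfl, h⟩
    rw [QuotientGroup.eq.2 h]

theorem exists_sigma_mk {ι : Type*} {H : ι → Subgroup Γ} (e : Σ i, Γ ⧸ H i) :
    ∃ (i : ι) (g : Γ), e = ⟨i, (g : Γ ⧸ H i)⟩ := by
  obtain ⟨i, q⟩ := e
  obtain ⟨g, rfl⟩ := QuotientGroup.mk_surjective q
  exact ⟨i, g, rfl⟩

/-- Disjointness at a vertex is the ping-pong condition `eq_of_smul_mem`. For connectedness, edges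
with trivial letter join the cosets of a fixed `g` in all vertex groups, and each generator moves
`g` within a component. -/
theorem isHalfSpaceSystem : IsHalfSpaceSystem D.origin D.reverse D.half D.core where
  bar_bar e := by
    obtain ⟨ε, g, rfl⟩ := exists_sigma_mk e
    rw [reverse_mk, reverse_mk, sigma_mk_eq_iff, D.letter_bar, D.bar_bar]
    refine ⟨rfl, ?_⟩
    simp
  compl e := by
    obtain ⟨ε, g, rfl⟩ := exists_sigma_mk e
    ext ω
    rw [reverse_mk, mem_half_mk, Set.mem_compl_iff, mem_half_mk, D.mem_bar_iff, mul_inv_rev,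
      mul_smul, smul_inv_smul]
  disjoint e e' ho hne := by
    obtain ⟨ε, g, rfl⟩ := exists_sigma_mk e
    obtain ⟨ε', g', rfl⟩ := exists_sigma_mk e'
    rw [origin_mk, origin_mk, sigma_mk_eq_iff] at ho
    refine Set.disjoint_left.2 fun ω h h' => hne ?_
    rw [mem_half_mk] at h h'
    obtain ⟨h1, h2⟩ := D.eq_of_smul_mem ε ε' ho.1 ((g⁻¹ * g')⁻¹) (inv_mem ho.2) _ h (by
      rwa [mul_inv_rev, inv_inv, smul_smul, mul_assoc, mul_inv_cancel, mul_one])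
    exact sigma_mk_eq_iff.2 ⟨h1, inv_mem_iff.1 h2⟩
  nonempty u := by
    obtain ⟨v, g, rfl⟩ := exists_sigma_mk u
    obtain ⟨ω, hω⟩ := D.base_nonempty v
    exact ⟨g • ω, D.mem_core_mk.2 (by rwa [inv_smul_smul])⟩
  base_disjoint e := by
    obtain ⟨ε, g, rfl⟩ := exists_sigma_mk e
    refine Set.disjoint_left.2 fun ω h h' => ?_
    rw [origin_mk, mem_core_mk] at h
    rw [mem_half_mk] at h'
    exact D.base_notMem _ _ h h'
  connected S hS hcl := by
    have hall : ∀ v (g : Γ), (⟨v, (g : Γ ⧸ P v)⟩ : Σ v, Γ ⧸ P v) ∈ S →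
        ∀ v', (⟨v', (g : Γ ⧸ P v')⟩ : Σ v, Γ ⧸ P v) ∈ S := by
      intro v g hv v'
      have := D.connected {v' | (⟨v', (g : Γ ⧸ P v')⟩ : Σ v, Γ ⧸ P v) ∈ S} ⟨v, hv⟩ (by
        intro ε hε h
        have := hcl ⟨ε, (g : Γ ⧸ C ε)⟩ h
        rwa [reverse_mk, origin_mk, hε, mul_one] at this)
      exact (this ▸ Set.mem_univ v' : _)
    have hgen : ∀ h g : Γ, (∀ v, (⟨v, (g : Γ ⧸ P v)⟩ : Σ v, Γ ⧸ P v) ∈ S) ↔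
        (∀ v, (⟨v, ((g * h : Γ) : Γ ⧸ P v)⟩ : Σ v, Γ ⧸ P v) ∈ S) := by
      intro h
      have hmem : h ∈ Subgroup.closure ((⋃ v, (P v : Set Γ)) ∪ Set.range x) := by
        rw [D.closure_eq]; exact Subgroup.mem_top h
      induction hmem using Subgroup.closure_induction with
      | mem h hh =>
        intro g
        rcases hh with hh | ⟨ε, rfl⟩
        · obtain ⟨v, hv⟩ := Set.mem_iUnion.1 hh
          have heq : (⟨v, (g : Γ ⧸ P v)⟩ : Σ v, Γ ⧸ P v) = ⟨v, ((g * h : Γ) : Γ ⧸ P v)⟩ :=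
            sigma_mk_eq_iff.2 ⟨rfl, by simpa using hv⟩
          exact ⟨fun H => hall v _ (heq ▸ H v), fun H => hall v _ (heq ▸ H v)⟩
        · constructor
          · intro H
            have := hcl ⟨ε, (g : Γ ⧸ C ε)⟩ (H (s ε))
            exact hall _ _ this
          · intro H
            have := hcl ⟨bar ε, ((g * x ε : Γ) : Γ ⧸ C (bar ε))⟩ (H _)
            rw [reverse_mk, origin_mk, D.letter_bar, mul_inv_cancel_right] at this
            exact hall _ _ this
      | one => intro g; rw [mul_one]
      | mul a b _ _ iha ihb => intro g; rw [iha, ihb, mul_assoc]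
      | inv a _ ih => intro g; rw [ih (g * a⁻¹), inv_mul_cancel_right]
    obtain ⟨u, hu⟩ := hS
    obtain ⟨v, g, rfl⟩ := exists_sigma_mk u
    refine Set.eq_univ_of_forall fun u' => ?_
    obtain ⟨v', g', rfl⟩ := exists_sigma_mk u'
    have := (hgen (g⁻¹ * g') g).1 (hall v g hu) v'
    rwa [mul_inv_cancel_left] at this

/-- `e` is the first edge of the geodesic from `u` to `v` in the Bass-Serre tree. -/
abbrev IsFirst (u v : Σ v, Γ ⧸ P v) (e : Σ ε, Γ ⧸ C ε) : Prop :=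
  IsFirstEdge D.origin D.half D.core u v e

variable {D}

theorem IsFirst.smul {v : V} {a b : Γ} {ε : Ed} {c : Γ}
    (h : D.IsFirst ⟨v, (a : Γ ⧸ P v)⟩ ⟨v, (b : Γ ⧸ P v)⟩ ⟨ε, (c : Γ ⧸ C ε)⟩) (g : Γ) :
    D.IsFirst ⟨v, ((g * a : Γ) : Γ ⧸ P v)⟩ ⟨v, ((g * b : Γ) : Γ ⧸ P v)⟩
      ⟨ε, ((g * c : Γ) : Γ ⧸ C ε)⟩ := by
  obtain ⟨h1, h2⟩ := h
  refine ⟨?_, fun ω hω => ?_⟩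
  · rw [origin_mk, sigma_mk_eq_iff] at h1 ⊢
    refine ⟨h1.1, ?_⟩
    have := h1.2
    simpa [mul_assoc] using this
  · rw [mem_core_mk, mul_inv_rev, mul_smul] at hω
    rw [mem_half_mk, mul_inv_rev, mul_smul]
    exact D.mem_half_mk.1 (h2 (D.mem_core_mk.2 hω))

variable (D)

include D in
-- The direction of `γ` is the marked point of the first edge from the base vertex towards its
-- `γ`-translate. The hypothesis on `p` makes the marked point of an edge independent of the coset
-- representative.
theorem exists_isDirectionMap {A X : Type*} [Group A] [MulAction A X] [Nonempty X] (j : A →* Γ)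
    (v₀ : V) (hj : j.range = P v₀) (p : Ed → X)
    (hp : ∀ ε, s ε = v₀ → ∀ a, j a ∈ C ε → a • p ε = p ε) :
    ∃ d : Γ → X, IsDirectionMap j d ∧
      ∀ γ, γ ∉ j.range → ∃ (ε : Ed) (a : A), s ε = v₀ ∧ d γ = a • p ε := by
  classical
  have hS := D.isHalfSpaceSystem
  have hbase : ∀ {e}, D.origin e = ⟨v₀, ((1 : Γ) : Γ ⧸ P v₀)⟩ →
      ∃ ε a, s ε = v₀ ∧ e = ⟨ε, (j a : Γ ⧸ C ε)⟩ := by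
    intro e he
    obtain ⟨ε, g, rfl⟩ := exists_sigma_mk e
    rw [origin_mk, sigma_mk_eq_iff] at he
    obtain ⟨hε, hg⟩ := he
    rw [hε, mul_one, inv_mem_iff, ← hj] at hg
    obtain ⟨a, rfl⟩ := hg
    exact ⟨ε, a, hε, rfl⟩
  have hpt : ∀ e : Σ ε, Γ ⧸ C ε, ∃ q : X, ∀ ε a, s ε = v₀ → e = ⟨ε, (j a : Γ ⧸ C ε)⟩ →
      q = a • p ε := by
    intro e
    by_cases h : ∃ ε a, s ε = v₀ ∧ e = ⟨ε, (j a : Γ ⧸ C ε)⟩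
    · obtain ⟨ε, a, hε, rfl⟩ := h
      refine ⟨a • p ε, fun ε' a' hε' he => ?_⟩
      rw [sigma_mk_eq_iff] at he
      obtain ⟨rfl, he⟩ := he
      rw [← map_inv, ← map_mul] at he
      have := hp ε hε _ he
      rw [mul_smul, inv_smul_eq_iff] at this
      exact this.symm
    · push Not at h
      exact ⟨Classical.arbitrary X, fun ε a hε he => absurd he (h ε a hε)⟩
  choose pt hpt using hpt
  have hpt' : ∀ ε a, s ε = v₀ → pt ⟨ε, (j a : Γ ⧸ C ε)⟩ = a • p ε := fun ε a hε =>
    hpt _ ε a hε rfl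
  have hvne : ∀ {γ δ : Γ}, γ⁻¹ * δ ∉ j.range →
      (⟨v₀, (γ : Γ ⧸ P v₀)⟩ : Σ v, Γ ⧸ P v) ≠ ⟨v₀, (δ : Γ ⧸ P v₀)⟩ := by
    intro γ δ h he
    rw [hj] at h
    exact h (sigma_mk_eq_iff.1 he).2
  have hvne1 : ∀ {γ : Γ}, γ ∉ j.range →
      (⟨v₀, ((1 : Γ) : Γ ⧸ P v₀)⟩ : Σ v, Γ ⧸ P v) ≠ ⟨v₀, (γ : Γ ⧸ P v₀)⟩ := fun h =>
    hvne (by simpa using h)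
  have hex : ∀ {γ δ : Γ}, γ⁻¹ * δ ∉ j.range →
      ∃ e, D.IsFirst ⟨v₀, (γ : Γ ⧸ P v₀)⟩ ⟨v₀, (δ : Γ ⧸ P v₀)⟩ e := by
    intro γ δ h
    obtain ⟨e, f, -, -, he, -⟩ := exists_redPath_isFirstEdge hS (hvne h)
    exact ⟨e, he⟩
  have hdex : ∀ γ : Γ, ∃ q : X, ∀ e,
      D.IsFirst ⟨v₀, ((1 : Γ) : Γ ⧸ P v₀)⟩ ⟨v₀, (γ : Γ ⧸ P v₀)⟩ e → q = pt e := by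
    intro γ
    by_cases h : ∃ e, D.IsFirst ⟨v₀, ((1 : Γ) : Γ ⧸ P v₀)⟩ ⟨v₀, (γ : Γ ⧸ P v₀)⟩ e
    · obtain ⟨e, he⟩ := h
      exact ⟨pt e, fun e' he' => by rw [IsFirstEdge.unique hS he he']⟩
    -- No first edge exists when `γ` fixes the base vertex; the value there is never used, as all
    -- conditions on `d` concern elements outside `j.range`.
    · exact ⟨Classical.arbitrary X, fun e he => absurd ⟨e, he⟩ h⟩
  choose d hd using hdex
  have htrans : ∀ {γ δ : Γ} {ε : Ed} {c : Γ},
      D.IsFirst ⟨v₀, (γ : Γ ⧸ P v₀)⟩ ⟨v₀, (δ : Γ ⧸ P v₀)⟩ ⟨ε, (c : Γ ⧸ C ε)⟩ →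
      d (γ⁻¹ * δ) = pt ⟨ε, ((γ⁻¹ * c : Γ) : Γ ⧸ C ε)⟩ := by
    intro γ δ ε c h
    have := IsFirst.smul h γ⁻¹
    rw [inv_mul_cancel] at this
    exact hd _ _ this
  have hmk : ∀ (γ : Γ) (a : A), ((γ * j a : Γ) : Γ ⧸ P v₀) = γ := by
    intro γ a
    refine (QuotientGroup.eq.2 ?_).symm
    rw [inv_mul_cancel_left, ← hj]
    exact ⟨a, rfl⟩
  refine ⟨d, ⟨?_, ?_, ?_, ?_⟩, ?_⟩
  · intro a γ hγ
    obtain ⟨e, he⟩ := hex (γ := 1) (δ := γ) (by simpa using hγ)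
    obtain ⟨ε, b, hε, rfl⟩ := hbase he.1
    have h1 := IsFirst.smul he (j a)
    have h2 := hmk 1 a
    rw [one_mul] at h2
    rw [mul_one, h2, ← map_mul] at h1
    rw [hd _ _ he, hd _ _ h1, hpt' _ _ hε, hpt' _ _ hε, mul_smul]
  · intro a γ hγ
    obtain ⟨e, he⟩ := hex (γ := 1) (δ := γ) (by simpa using hγ)
    rw [hd _ _ he]
    refine hd _ _ ?_
    rwa [hmk]
  · intro γ γ' hγ hγ' hγγ' hne
    obtain ⟨e, he⟩ := hex (γ := 1) (δ := γ) (by simpa using hγ)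
    obtain ⟨e', he'⟩ := hex (γ := 1) (δ := γ') (by simpa using hγ')
    obtain ⟨f, hf⟩ := hex (γ := γ) (δ := 1) (by simpa using inv_mem_iff.not.2 hγ)
    have hee' : e ≠ e' := by
      rintro rfl
      exact hne ((hd _ _ he).trans (hd _ _ he').symm)
    have h1 := IsFirstEdge.tri hS (hvne1 hγ) he he' hee' hf
    obtain ⟨ε, c, rfl⟩ := exists_sigma_mk f
    have h2 := htrans hf
    rw [mul_one] at h2
    rw [h2]
    exact htrans h1
  · intro w
    have hfin := finite_isFirstEdge_ne hS ⟨v₀, ((1 : Γ) : Γ ⧸ P v₀)⟩ ⟨v₀, (w : Γ ⧸ P v₀)⟩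
    -- Separating vertices of every type are represented; only those in the orbit of the base vertex
    -- are needed.
    refine ⟨hfin.toFinset.image fun u => Quotient.out u.2, fun δ hδ hδw hne => ?_⟩
    obtain ⟨f, hf⟩ := hex (γ := δ) (δ := 1) (by simpa using inv_mem_iff.not.2 hδ)
    obtain ⟨f', hf'⟩ := hex hδw
    have hff' : f ≠ f' := by
      rintro rfl
      obtain ⟨ε, c, rfl⟩ := exists_sigma_mk f
      have h2 := htrans hf
      rw [mul_one] at h2
      exact hne (h2.trans (htrans hf').symm)
    refine ⟨_, Finset.mem_image_of_mem _ (hfin.mem_toFinset.2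
      ⟨(hvne1 hδ).symm, hvne hδw, f, f', hf, hf', hff'⟩), ?_⟩
    rw [hj]
    exact QuotientGroup.eq.1 (QuotientGroup.out_eq' _)
  · intro γ hγ
    obtain ⟨e, he⟩ := hex (γ := 1) (δ := γ) (by simpa using hγ)
    obtain ⟨ε, b, hε, rfl⟩ := hbase he.1
    exact ⟨ε, b, hε, by rw [hd _ _ he, hpt' _ _ hε]⟩

end IsPingPong

end PingPong


/-! ### Cocycles on trees are trivial -/

section TreeCocycle

variable {V K : Type*} [Group K] {H : SimpleGraph V}

/-- The product of a group-valued function on pairs of adjacent vertices along a walk. -/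
def walkProd (κ : V → V → K) : ∀ {u v : V}, H.Walk u v → K
  | _, _, .nil => 1
  | u, _, .cons (v := u') _ p => κ u' u * walkProd κ p

theorem walkProd_concat (κ : V → V → K) {u v w : V} (p : H.Walk u v) (h : H.Adj v w) :
    walkProd κ (p.concat h) = walkProd κ p * κ w v := by
  induction p with
  | nil => simp [walkProd, SimpleGraph.Walk.concat_nil]
  | cons h' p ih => rw [SimpleGraph.Walk.concat_cons, walkProd, walkProd, ih, mul_assoc]

/-- Multiply `κ` along the unique path from a root. Of two adjacent vertices, one path extends the
other by the joining edge. -/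
theorem exists_trivialization (hH : H.IsTree) (κ : V → V → K)
    (hκ : ∀ u v, H.Adj u v → κ u v * κ v u = 1) :
    ∃ τ : V → K, ∀ u v, H.Adj u v → τ v * κ u v = τ u := by
  classical
  obtain ⟨r⟩ := hH.connected.nonempty
  choose p hp hpu using fun v => hH.existsUnique_path r v
  simp only at hp hpu
  have key : ∀ u v (h : H.Adj u v), v ∉ (p u).support →
      walkProd κ (p v) = walkProd κ (p u) * κ v u := by
    intro u v h hv
    rw [← hpu v _ ((hp u).concat hv h), walkProd_concat]
  refine ⟨fun v => walkProd κ (p v), fun u v h => ?_⟩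
  by_cases hv : v ∈ (p u).support
  · have h1 := hpu v _ ((hp u).takeUntil hv)
    have h2 := SimpleGraph.Walk.endpoint_notMem_support_takeUntil (hp u) hv h.ne
    rw [h1] at h2
    exact (key v u h.symm h2).symm
  · change walkProd κ (p v) * κ u v = walkProd κ (p u)
    rw [key u v h hv, mul_assoc, hκ v u h.symm, mul_one]

end TreeCocycle

/-! ### Splitting a free set into two half-spaces -/

section HalfSpaceParam

variable {C G Ed : Type*} [Group C] [Group G]

/-- As a free `C`-set, the model consists of the half-space of `ε` and its complement. Each has
countably infinitely many orbits, so both are copies of `C × ℕ` and can later be exchanged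
equivariantly. -/
theorem exists_halfSpace_param [Countable G] [Countable Ed] (ι : C →* G)
    (hι : Function.Injective ι) (ε : Ed) :
    ∃ Φ : (C × ℕ) ⊕ (C × ℕ) ≃ G × (ℕ ⊕ Ed × ℕ),
      (∀ c n, Φ (.inl (c, n)) = (ι c, .inr (ε, n))) ∧
      ∀ c c' n, Φ (.inr (c * c', n)) = (ι c * (Φ (.inr (c', n))).1, (Φ (.inr (c', n))).2) := by
  let S : Set (G × (ℕ ⊕ Ed × ℕ)) := {w | ∀ c n, w ≠ (ι c, .inr (ε, n))}
  let r : Setoid S :=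
    { r := fun w w' => ∃ c, w'.1 = (ι c * w.1.1, w.1.2)
      iseqv := ⟨fun w => ⟨1, by simp⟩,
        fun {w w'} ⟨c, hc⟩ => ⟨c⁻¹, by simp [hc]⟩,
        fun {w w' w''} ⟨c, hc⟩ ⟨c', hc'⟩ => ⟨c' * c, by simp [hc, hc', mul_assoc]⟩⟩ }
  -- The summand `ℕ` lies outside every half-space and supplies infinitely many orbits.
  have hinf : Infinite (Quotient r) := by
    refine Infinite.of_injective
      (fun n : ℕ => Quotient.mk r ⟨(1, .inl n), fun c n h => by simp at h⟩) fun m n h => ?_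
    obtain ⟨c, hc⟩ := Quotient.exact h
    simpa using (congrArg Prod.snd hc).symm
  obtain ⟨q⟩ : Nonempty (ℕ ≃ Quotient r) := nonempty_equiv_of_countable
  let rep : ℕ → S := fun n => (q n).out
  let F : (C × ℕ) ⊕ (C × ℕ) → G × (ℕ ⊕ Ed × ℕ) :=
    Sum.elim (fun z => (ι z.1, .inr (ε, z.2))) fun z => (ι z.1 * (rep z.2).1.1, (rep z.2).1.2)
  have hFS : ∀ c n, F (.inr (c, n)) ∈ S := by
    intro c n c' m h
    obtain ⟨h1, h2⟩ := Prod.mk.inj h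
    refine (rep n).2 (c⁻¹ * c') m (Prod.ext ?_ h2)
    rw [map_mul, map_inv]
    exact (inv_mul_eq_of_eq_mul h1.symm).symm
  have hbij : Function.Bijective F := by
    constructor
    · rintro (⟨c, n⟩ | ⟨c, n⟩) (⟨c', n'⟩ | ⟨c', n'⟩) h
      · obtain ⟨h1, h2⟩ := Prod.mk.inj h
        simp only [Sum.inr.injEq, Prod.mk.injEq, true_and] at h2
        obtain rfl : c = c' := hι h1
        obtain rfl : n = n' := h2
        rfl
      · exact absurd h.symm (hFS c' n' c n)
      · exact absurd h (hFS c n c' n')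
      · obtain ⟨h1, h2⟩ := Prod.mk.inj h
        simp only at h1 h2
        have hn : n = n' := by
          refine q.injective ?_
          rw [← Quotient.out_eq (q n), ← Quotient.out_eq (q n')]
          refine Quotient.sound ⟨c'⁻¹ * c, Prod.ext ?_ h2.symm⟩
          change (rep n').1.1 = ι (c'⁻¹ * c) * (rep n).1.1
          rw [map_mul, map_inv, mul_assoc, h1, inv_mul_cancel_left]
        subst hn
        rw [hι (mul_right_cancel h1)]
    · intro w
      by_cases hw : w ∈ S
      · have h1 : Quotient.mk r (q (q.symm (Quotient.mk r ⟨w, hw⟩))).out = Quotient.mk r ⟨w, hw⟩ := by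
          rw [Quotient.out_eq, q.apply_symm_apply]
        obtain ⟨c, hc⟩ := Quotient.exact h1
        exact ⟨.inr (c, q.symm (Quotient.mk r ⟨w, hw⟩)), hc.symm⟩
      · simp only [S, Set.mem_ofPred_eq, not_forall, not_not] at hw
        obtain ⟨c, n, rfl⟩ := hw
        exact ⟨.inl (c, n), rfl⟩
  refine ⟨Equiv.ofBijective F hbij, fun c n => rfl, fun c c' n => ?_⟩
  change (ι (c * c') * (rep n).1.1, (rep n).1.2) = (ι c * (ι c' * (rep n).1.1), (rep n).1.2)
  rw [map_mul, mul_assoc]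

end HalfSpaceParam

/-! ### A ping-pong action of the fundamental group -/

namespace GraphOfGroups

variable {V E : Type*} {G : V → Type*} {C : E → Type*} [∀ v, Group (G v)] [∀ e, Group (C e)]
  (Y : GraphOfGroups V E G C)

/-- The origin of an oriented edge: `(e, true)` is `e` with its given orientation, `(e, false)`
the reversed edge. -/
def origin : E × Bool → V
  | (e, true) => Y.src e
  | (e, false) => Y.tgt e

/-- The inclusion of an edge group into the vertex group at the origin of an oriented edge. -/
def edgeHom : ∀ ε : E × Bool, C ε.1 →* G (Y.origin ε)
  | (e, true) => Y.srcHom e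
  | (e, false) => Y.tgtHom e

theorem edgeHom_injective : ∀ ε, Function.Injective (Y.edgeHom ε)
  | (e, true) => Y.srcHom_injective e
  | (e, false) => Y.tgtHom_injective e

/-- Reversal of oriented edges. -/
def flip (ε : E × Bool) : E × Bool := (ε.1, !ε.2)

variable (T : Set E)

/-- The vertex group in the fundamental group. -/
def toFundamentalGroup (v : V) : G v →* Y.FundamentalGroup T :=
  (QuotientGroup.mk' _).comp (Y.vertexHom v)

/-- The element of the fundamental group that crosses an oriented edge. -/
def letter : E × Bool → Y.FundamentalGroup T
  | (e, true) => (QuotientGroup.mk' _ (Y.stableLetter e))⁻¹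
  | (e, false) => QuotientGroup.mk' _ (Y.stableLetter e)

/-- The group of an oriented edge, inside the fundamental group. -/
def edgeGroup (ε : E × Bool) : Subgroup (Y.FundamentalGroup T) :=
  ((Y.toFundamentalGroup T (Y.origin ε)).comp (Y.edgeHom ε)).range

theorem letter_flip (ε : E × Bool) : Y.letter T (flip ε) = (Y.letter T ε)⁻¹ := by
  rcases ε with ⟨e, _ | _⟩
  · rfl
  · exact (inv_inv _).symm

theorem letter_eq_one {ε : E × Bool} (hε : ε.1 ∈ T) : Y.letter T ε = 1 := by
  have h : QuotientGroup.mk' (Subgroup.normalClosure (Y.relators T)) (Y.stableLetter ε.1) = 1 :=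
    (QuotientGroup.eq_one_iff _).2 (Subgroup.subset_normalClosure (Or.inr ⟨_, hε, rfl⟩))
  rcases ε with ⟨e, _ | _⟩
  · exact h
  · exact inv_eq_one.2 h

theorem letter_conj (ε : E × Bool) (c : C ε.1) :
    (Y.letter T ε)⁻¹ * Y.toFundamentalGroup T (Y.origin ε) (Y.edgeHom ε c) * Y.letter T ε =
      Y.toFundamentalGroup T (Y.origin (flip ε)) (Y.edgeHom (flip ε) c) := by
  have h : ∀ e (c : C e), QuotientGroup.mk' (Subgroup.normalClosure (Y.relators T))
      (Y.stableLetter e) * Y.toFundamentalGroup T (Y.src e) (Y.srcHom e c) *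
      (QuotientGroup.mk' _ (Y.stableLetter e))⁻¹ =
      Y.toFundamentalGroup T (Y.tgt e) (Y.tgtHom e c) := by
    intro e c
    rw [← mul_inv_eq_one]
    exact (QuotientGroup.eq_one_iff _).2 (Subgroup.subset_normalClosure (Or.inl ⟨e, c, rfl⟩))
  rcases ε with ⟨e, _ | _⟩
  · change _ * Y.toFundamentalGroup T (Y.tgt e) (Y.tgtHom e c) * _ =
      Y.toFundamentalGroup T (Y.src e) (Y.srcHom e c)
    rw [← h e c]
    change (QuotientGroup.mk' _ (Y.stableLetter e))⁻¹ * _ *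
      (QuotientGroup.mk' _ (Y.stableLetter e)) = _
    group
  · change _ * Y.toFundamentalGroup T (Y.src e) (Y.srcHom e c) * _ =
      Y.toFundamentalGroup T (Y.tgt e) (Y.tgtHom e c)
    rw [← h e c]
    change (QuotientGroup.mk' _ (Y.stableLetter e))⁻¹⁻¹ * _ *
      (QuotientGroup.mk' _ (Y.stableLetter e))⁻¹ = _
    rw [inv_inv]

theorem closure_fundamentalGroup :
    Subgroup.closure ((⋃ v, ((Y.toFundamentalGroup T v).range : Set (Y.FundamentalGroup T))) ∪
      Set.range (Y.letter T)) = ⊤ := by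
  rw [eq_top_iff]
  intro g _
  obtain ⟨w, rfl⟩ := QuotientGroup.mk'_surjective _ g
  induction w using Monoid.Coprod.induction_on with
  | inl m =>
    induction m using Monoid.CoprodI.induction_on with
    | one => rw [map_one, map_one]; exact one_mem _
    | of v g =>
      exact Subgroup.subset_closure (Or.inl (Set.mem_iUnion.2 ⟨v, g, rfl⟩))
    | mul a b ha hb =>
      rw [map_mul, map_mul]
      exact mul_mem (ha trivial) (hb trivial)
  | inr m =>
    have hof : ∀ e, QuotientGroup.mk' (Subgroup.normalClosure (Y.relators T))
        (Monoid.Coprod.inr (FreeGroup.of e)) ∈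
        Subgroup.closure ((⋃ v, ((Y.toFundamentalGroup T v).range : Set (Y.FundamentalGroup T))) ∪
          Set.range (Y.letter T)) := fun e =>
      Subgroup.subset_closure (Or.inr ⟨(e, false), rfl⟩)
    induction m using FreeGroup.induction_on with
    | C1 => rw [map_one, map_one]; exact one_mem _
    | of e => exact hof e
    | inv_of e _ => rw [map_inv, map_inv]; exact inv_mem (hof e)
    | mul a b ha hb =>
      rw [map_mul, map_mul]
      exact mul_mem (ha trivial) (hb trivial)
  | mul a b ha hb =>
    rw [map_mul]
    exact mul_mem (ha trivial) (hb trivial)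

instance [Countable V] [Countable E] [∀ v, Countable (G v)] :
    Countable (Y.FundamentalGroup T) := by
  have h0 : Countable (Σ v, G v) := inferInstance
  have h1 : Countable (Monoid.CoprodI G) := by
    have : Countable (FreeMonoid (Σ v, G v)) := inferInstanceAs (Countable (List _))
    exact Con.mk'_surjective.countable
  have h2 : Countable (FreeGroup E) := by
    have : Countable (List (E × Bool)) := inferInstance
    exact Quot.mk_surjective.countable
  have h3 : Countable Y.FreeProd := by
    have : Countable (FreeMonoid (Monoid.CoprodI G ⊕ FreeGroup E)) :=
      inferInstanceAs (Countable (List _))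
    exact Con.mk'_surjective.countable
  exact (QuotientGroup.mk'_surjective _).countable

variable {Y T}

/-- Arbitrary identifications with `Ω` fail to match `θ` along an edge by a permutation. A tree has
no monodromy, so correcting at each vertex removes all these defects on `T`. -/
theorem IsSpanningTree.exists_trivialization (hT : Y.IsSpanningTree T) {W : V → Type*}
    {Ω : Type*} (f : ∀ v, W v ≃ Ω) (θ : ∀ e, W (Y.src e) ≃ W (Y.tgt e)) :
    ∃ F : ∀ v, W v ≃ Ω, ∀ e ∈ T, ∀ w, F (Y.tgt e) (θ e w) = F (Y.src e) w := by
  classical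
  let t : E → Equiv.Perm Ω := fun e => ((f _).symm.trans (θ e)).trans (f _)
  let κ : V → V → Equiv.Perm Ω := fun u v =>
    if h : ∃ e ∈ T, Y.src e = u ∧ Y.tgt e = v then t h.choose
    else if h : ∃ e ∈ T, Y.src e = v ∧ Y.tgt e = u then (t h.choose)⁻¹ else 1
  have hκ1 : ∀ e ∈ T, κ (Y.src e) (Y.tgt e) = t e := by
    intro e he
    have h : ∃ e' ∈ T, Y.src e' = Y.src e ∧ Y.tgt e' = Y.tgt e := ⟨e, he, rfl, rfl⟩
    have heq : h.choose = e := hT.injOn h.choose_spec.1 he (by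
      simp only [h.choose_spec.2.1, h.choose_spec.2.2])
    simp only [κ, dif_pos h, heq]
  have hκ2 : ∀ e ∈ T, κ (Y.tgt e) (Y.src e) = (t e)⁻¹ := by
    intro e he
    have h' : ¬ ∃ e' ∈ T, Y.src e' = Y.tgt e ∧ Y.tgt e' = Y.src e := by
      rintro ⟨e', he', h1, h2⟩
      have heq : e' = e := hT.injOn he' he (by simp only [h1, h2, Sym2.eq_swap])
      subst heq
      exact hT.not_loop _ he h1
    have h : ∃ e' ∈ T, Y.src e' = Y.src e ∧ Y.tgt e' = Y.tgt e := ⟨e, he, rfl, rfl⟩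
    have heq : h.choose = e := hT.injOn h.choose_spec.1 he (by
      simp only [h.choose_spec.2.1, h.choose_spec.2.2])
    simp only [κ, dif_neg h', dif_pos h, heq]
  obtain ⟨τ, hτ⟩ := ConvGroups.exists_trivialization hT.isTree κ (by
    intro u v h
    rw [SimpleGraph.fromEdgeSet_adj] at h
    obtain ⟨⟨e, he, heq⟩, -⟩ := h
    simp only [Sym2.eq_iff] at heq
    rcases heq with ⟨rfl, rfl⟩ | ⟨rfl, rfl⟩
    · rw [hκ1 e he, hκ2 e he, mul_inv_cancel]
    · rw [hκ1 e he, hκ2 e he, inv_mul_cancel])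
  refine ⟨fun v => (f v).trans (τ v), fun e he w => ?_⟩
  have h := hτ (Y.src e) (Y.tgt e) (by
    rw [SimpleGraph.fromEdgeSet_adj]
    exact ⟨⟨e, he, rfl⟩, hT.not_loop e he⟩)
  rw [hκ1 e he] at h
  have h2 := Equiv.congr_fun h (f _ w)
  simpa [t] using h2

/-- A free `G v`-set with room for one half-space for each oriented edge. -/
abbrev HalfSpaceModel (_ : GraphOfGroups V E G C) (v : V) : Type _ := G v × (ℕ ⊕ (E × Bool) × ℕ)

/-- Each vertex group acts freely on its model, and all models are identified with `ℕ` so that the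
stable letters of `T` act trivially. The other relators die because the gluing maps are equivariant
under the edge groups. Freeness of the vertex actions gives injectivity into the fundamental group.
-/
theorem IsSpanningTree.exists_isPingPong [Countable V] [Countable E] [∀ v, Countable (G v)]
    (hT : Y.IsSpanningTree T) :
    ∃ (_ : MulAction (Y.FundamentalGroup T) ℕ) (Z : E × Bool → Set ℕ) (B : V → Set ℕ),
      IsPingPong Y.origin flip (fun v => (Y.toFundamentalGroup T v).range) (Y.edgeGroup T)
        (Y.letter T) Z B ∧
      ∀ v, Function.Injective (Y.toFundamentalGroup T v) := by
  choose Φs hs hs' using fun e =>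
    exists_halfSpace_param (Y.srcHom e) (Y.srcHom_injective e) ((e, true) : E × Bool)
  choose Φt ht ht' using fun e =>
    exists_halfSpace_param (Y.tgtHom e) (Y.tgtHom_injective e) ((e, false) : E × Bool)
  have hΦs : ∀ e c (z : (C e × ℕ) ⊕ (C e × ℕ)),
      Φs e (Sum.map (fun y => (c * y.1, y.2)) (fun y => (c * y.1, y.2)) z) =
      (Y.srcHom e c * (Φs e z).1, (Φs e z).2) := by
    rintro e c (⟨c', n⟩ | ⟨c', n⟩)
    · simp [hs]
    · exact hs' e c c' n
  have hΦt : ∀ e c (z : (C e × ℕ) ⊕ (C e × ℕ)),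
      Φt e (Sum.map (fun y => (c * y.1, y.2)) (fun y => (c * y.1, y.2)) z) =
      (Y.tgtHom e c * (Φt e z).1, (Φt e z).2) := by
    rintro e c (⟨c', n⟩ | ⟨c', n⟩)
    · simp [ht]
    · exact ht' e c c' n
  have hW : ∀ v, Nonempty (Y.HalfSpaceModel v ≃ ℕ) := fun v => nonempty_equiv_of_countable
  -- The swap sends the half-space at one end of `e` onto the complement of the half-space at the
  -- other end, which is what `mem_bar_iff` requires.
  let θ : ∀ e, Y.HalfSpaceModel (Y.src e) ≃ Y.HalfSpaceModel (Y.tgt e) := fun e =>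
    ((Φs e).symm.trans (Equiv.sumComm _ _)).trans (Φt e)
  have hθ : ∀ e z, θ e (Φs e z) = Φt e z.swap := by
    intro e z
    simp [θ]
  obtain ⟨F, hF⟩ := hT.exists_trivialization (fun v => (hW v).some) θ
  let lmul : ∀ v, G v → Equiv.Perm (Y.HalfSpaceModel v) := fun v g =>
    (Equiv.mulLeft g).prodCongr (Equiv.refl _)
  have hlmul : ∀ v g w, lmul v g w = (g * w.1, w.2) := fun _ _ _ => rfl
  let ρ : ∀ v, G v →* Equiv.Perm ℕ := fun v =>
    { toFun := fun g => ((F v).symm.trans (lmul v g)).trans (F v)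
      map_one' := by ext n; simp [hlmul]
      map_mul' := fun g h => by ext n; simp [hlmul, mul_assoc] }
  have hρ : ∀ v g (w : Y.HalfSpaceModel v), ρ v g (F v w) = F v (g * w.1, w.2) := by
    intro v g w
    simp [ρ, hlmul]
  let t : E → Equiv.Perm ℕ := fun e => ((F (Y.src e)).symm.trans (θ e)).trans (F (Y.tgt e))
  have htθ : ∀ e w, t e (F (Y.src e) w) = F (Y.tgt e) (θ e w) := by
    intro e w
    simp [t]
  let ψ₀ : Y.FreeProd →* Equiv.Perm ℕ :=
    Monoid.Coprod.lift (Monoid.CoprodI.lift ρ) (FreeGroup.lift t)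
  have hψv : ∀ v g, ψ₀ (Y.vertexHom v g) = ρ v g := by
    intro v g
    simp [ψ₀, vertexHom]
  have hψt : ∀ e, ψ₀ (Y.stableLetter e) = t e := by
    intro e
    simp [ψ₀, stableLetter]
  have hker : Subgroup.normalClosure (Y.relators T) ≤ ψ₀.ker := by
    refine Subgroup.normalClosure_le_normal ?_
    rintro _ (⟨e, c, rfl⟩ | ⟨e, he, rfl⟩)
    · rw [SetLike.mem_coe, MonoidHom.mem_ker, map_mul, map_mul, map_mul, map_inv, map_inv, hψv,
        hψv, hψt, mul_inv_eq_one, mul_inv_eq_iff_eq_mul]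
      refine Equiv.ext fun n => ?_
      obtain ⟨w, rfl⟩ := (F (Y.src e)).surjective n
      obtain ⟨z, rfl⟩ := (Φs e).surjective w
      rw [Equiv.Perm.mul_apply, Equiv.Perm.mul_apply, hρ, htθ, htθ, hρ, ← hΦs, hθ, hθ, ← hΦt]
      rcases z with z | z <;> rfl
    · rw [SetLike.mem_coe, MonoidHom.mem_ker, hψt]
      refine Equiv.ext fun n => ?_
      obtain ⟨w, rfl⟩ := (F (Y.src e)).surjective n
      rw [htθ, hF e he]
      rfl
  let ψ : Y.FundamentalGroup T →* Equiv.Perm ℕ := QuotientGroup.lift _ ψ₀ hker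
  have hψV : ∀ v g (w : Y.HalfSpaceModel v),
      ψ (Y.toFundamentalGroup T v g) (F v w) = F v (g * w.1, w.2) := by
    intro v g w
    rw [← hρ, ← hψv]
    rfl
  have hψt' : ∀ e, ψ (QuotientGroup.mk' _ (Y.stableLetter e)) = t e := fun e => hψt e
  have hFne : ∀ {u v : V} (_ : u = v) {w : Y.HalfSpaceModel u} {w' : Y.HalfSpaceModel v},
      F u w = F v w' → w.2 = w'.2 := by
    rintro u v rfl w w' h
    rw [(F u).injective h]
  let act : MulAction (Y.FundamentalGroup T) ℕ := MulAction.compHom ℕ ψ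
  have hact : ∀ (g : Y.FundamentalGroup T) (n : ℕ), g • n = ψ g n := fun _ _ => rfl
  refine ⟨act, fun ε => {n | ∃ c m, n = F (Y.origin ε) (Y.edgeHom ε c, .inr (ε, m))},
    fun v => {n | ∃ g m, n = F v (g, .inl m)}, ⟨?_, ?_, ?_, ?_, ?_, ?_, ?_, ?_, ?_, ?_, ?_, ?_⟩, ?_⟩
  · rintro ⟨e, _ | _⟩ <;> rfl
  · rintro ε _ ⟨c, rfl⟩
    exact ⟨_, rfl⟩
  · exact Y.letter_flip T
  · rintro ε _ ⟨c, rfl⟩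
    exact ⟨c, (Y.letter_conj T ε c).symm⟩
  · rintro ε _ ⟨c, rfl⟩ _ ⟨c', m, rfl⟩
    refine ⟨c * c', m, ?_⟩
    rw [hact, MonoidHom.comp_apply, hψV, map_mul]
  · rintro ε ε' hs _ ⟨g, rfl⟩ _ ⟨c, m, rfl⟩ ⟨c', m', h⟩
    rw [hact, hψV] at h
    have h1 := hFne hs h
    simp only [Sum.inr.injEq, Prod.mk.injEq] at h1
    obtain ⟨rfl, rfl⟩ := h1
    refine ⟨rfl, c' * c⁻¹, ?_⟩
    have h2 : g * Y.edgeHom ε c = Y.edgeHom ε c' :=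
      congrArg Prod.fst ((F (Y.origin ε)).injective h)
    rw [MonoidHom.comp_apply, map_mul, map_inv, ← h2, mul_inv_cancel_right]
  · have hZs : ∀ e z, (∃ c m, F (Y.src e) (Φs e z) = F (Y.src e) (Y.srcHom e c, .inr ((e, true), m)))
        ↔ z.isLeft := by
      intro e z
      constructor
      · rintro ⟨c, m, h⟩
        have := (F (Y.src e)).injective h
        rw [← hs] at this
        rw [(Φs e).injective this]
        rfl
      · intro h
        obtain ⟨⟨c, m⟩, rfl⟩ := Sum.isLeft_iff.1 h
        exact ⟨c, m, by rw [hs]⟩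
    have hZt : ∀ e z,
        (∃ c m, F (Y.tgt e) (Φt e z) = F (Y.tgt e) (Y.tgtHom e c, .inr ((e, false), m)))
        ↔ z.isLeft := by
      intro e z
      constructor
      · rintro ⟨c, m, h⟩
        have := (F (Y.tgt e)).injective h
        rw [← ht] at this
        rw [(Φt e).injective this]
        rfl
      · intro h
        obtain ⟨⟨c, m⟩, rfl⟩ := Sum.isLeft_iff.1 h
        exact ⟨c, m, by rw [ht]⟩
    rintro ⟨e, _ | _⟩ n
    · obtain ⟨w, rfl⟩ := (F (Y.src e)).surjective n
      obtain ⟨z, rfl⟩ := (Φs e).surjective w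
      change (∃ c m, F (Y.src e) (Φs e z) = F (Y.src e) (Y.srcHom e c, .inr ((e, true), m))) ↔
        ¬ ∃ c m, ψ (QuotientGroup.mk' _ (Y.stableLetter e)) (F (Y.src e) (Φs e z)) =
          F (Y.tgt e) (Y.tgtHom e c, .inr ((e, false), m))
      rw [hψt', htθ, hθ, hZs, hZt]
      rcases z with z | z <;> simp
    · obtain ⟨w, rfl⟩ := (F (Y.tgt e)).surjective n
      obtain ⟨z, rfl⟩ := (Φt e).surjective w
      have h1 : ψ (QuotientGroup.mk' _ (Y.stableLetter e))⁻¹ (F (Y.tgt e) (Φt e z)) =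
          F (Y.src e) (Φs e z.swap) := by
        rw [map_inv, hψt', Equiv.Perm.inv_eq_iff_eq, htθ, hθ, Sum.swap_swap]
      change (∃ c m, F (Y.tgt e) (Φt e z) = F (Y.tgt e) (Y.tgtHom e c, .inr ((e, false), m))) ↔
        ¬ ∃ c m, ψ (QuotientGroup.mk' _ (Y.stableLetter e))⁻¹ (F (Y.tgt e) (Φt e z)) =
          F (Y.src e) (Y.srcHom e c, .inr ((e, true), m))
      rw [h1, hZs, hZt]
      rcases z with z | z <;> simp
  · rintro v _ ⟨g, rfl⟩ _ ⟨g', m, rfl⟩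
    exact ⟨g * g', m, by rw [hact, hψV]⟩
  · exact fun v => ⟨_, 1, 0, rfl⟩
  · rintro ε _ ⟨g, m, rfl⟩ ⟨c, m', h⟩
    simpa using hFne rfl h
  · exact Y.closure_fundamentalGroup T
  · intro S hS hcl
    obtain ⟨u, hu⟩ := hS
    refine Set.eq_univ_of_forall fun v => ?_
    obtain ⟨p⟩ := hT.isTree.connected.preconnected u v
    induction p with
    | nil => exact hu
    | cons h p ih =>
      refine ih ?_
      rw [SimpleGraph.fromEdgeSet_adj] at h
      obtain ⟨⟨e, he, heq⟩, -⟩ := h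
      simp only [Sym2.eq_iff] at heq
      rcases heq with ⟨rfl, rfl⟩ | ⟨rfl, rfl⟩
      · exact hcl (e, true) (Y.letter_eq_one T he) hu
      · exact hcl (e, false) (Y.letter_eq_one T he) hu
  · intro v g g' h
    have h1 := hψV v g (1, .inl 0)
    rw [h, hψV] at h1
    have := congrArg Prod.fst ((F v).injective h1)
    simpa using this.symm

end GraphOfGroups


/-! ### Transfer to the required universe and assembly -/

section Transfer

variable {G : Type*} [Group G] {X X' : Type*} [TopologicalSpace X] [MulAction G X]
  [TopologicalSpace X'] [MulAction G X'] {π : X → X'}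

theorem image_limitSet_subset [CompactSpace X] [T2Space X'] (hc : Continuous π)
    (hs : Function.Surjective π) (hπ : ∀ (g : G) (x : X), π (g • x) = g • π x) (H : Subgroup G) :
    π '' limitSet X H ⊆ limitSet X' H := by
  rintro _ ⟨ξ, ⟨h, hinj, hH, η, hη⟩, rfl⟩
  exact ⟨h, hinj, hH, π η, hη.map hc hs hπ⟩

/-- Every convergence action on a compact metrizable space is conjugate to one on a subspace of
`ℓ^∞`. -/
theorem IsConvergenceAction.exists_conjugate [CompactSpace X] [TopologicalSpace.MetrizableSpace X]
    (hX : IsConvergenceAction G X) :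
    ∃ (M : Type) (_ : TopologicalSpace M) (_ : CompactSpace M)
      (_ : TopologicalSpace.MetrizableSpace M) (_ : MulAction G M), IsConvergenceAction G M ∧
      (IsNonElementary G X → IsNonElementary G M) := by
  let := TopologicalSpace.metrizableSpaceMetric X
  -- The range of the embedding lies in a space of bounded real sequences, hence in `Type`, whatever
  -- the universe of `X`.
  obtain ⟨f, hf⟩ := TopologicalSpace.exists_embedding_l_infty X
  let e : X ≃ₜ Set.range f := hf.toHomeomorph
  let : MulAction G (Set.range f) := e.symm.toEquiv.mulAction G
  have he : ∀ (g : G) (x : X), e (g • x) = g • e x := by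
    intro g x
    change _ = e (g • e.symm (e x))
    rw [e.symm_apply_apply]
  have := hX.continuous_smul
  have : ContinuousConstSMul G (Set.range f) := ⟨fun g => by
    change Continuous fun x => e (g • e.symm x)
    fun_prop⟩
  refine ⟨Set.range f, inferInstance, e.compactSpace, inferInstance, inferInstance,
    hX.map e.continuous e.surjective he, fun h => ?_⟩
  unfold IsNonElementary at h ⊢
  rw [← e.injective.encard_image] at h
  exact h.trans (Set.encard_le_encard (image_limitSet_subset e.continuous e.surjective he ⊤))

/-- The action on a point. -/
theorem exists_isConvergenceAction_punit (G : Type*) [Group G] :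
    ∃ _ : MulAction G PUnit.{1}, IsConvergenceAction G PUnit.{1} :=
  ⟨{ smul := fun _ x => x, one_smul := fun _ => rfl, mul_smul := fun _ _ _ => rfl }, ⟨⟨⟩⟩,
    ⟨fun _ => continuous_id⟩, fun _ _ => ⟨id, strictMono_id, ⟨⟩, ⟨⟩,
      fun _ _ _ _ hU => .of_forall fun _ _ _ => mem_of_mem_nhds hU⟩⟩

end Transfer

section Collapse

variable {G : Type*} [Group G] {X : Type*} [TopologicalSpace X] [MulAction G X] [CompactSpace X]
  [T2Space X] {ι : Type*} {H : ι → Subgroup G}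

theorem collapseRel_iff_mem_limitSet (hX : IsConvergenceAction G X)
    (h3 : ∀ a b : X, ∃ c, c ≠ a ∧ c ≠ b) (hcyc : ∀ i, IsInfiniteCyclic (H i))
    (hmal : ∀ i, IsDynamicallyMalnormal X (H i)) {i : ι} {y : X} (hy : y ∈ limitSet X (H i))
    (x : X) : CollapseRel X H x y ↔ x ∈ limitSet X (H i) := by
  constructor
  · rintro (rfl | ⟨k, g, hx, hgy⟩)
    · exact hy
    · have := smul_mem_limitSet_of_mem hX h3 (hcyc k) (hmal i) (g := g⁻¹) hgy
        (by rwa [inv_smul_smul]) hx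
      rwa [inv_smul_smul] at this
  · intro hx
    exact .inr ⟨i, 1, by rwa [one_smul], by rwa [one_smul]⟩

/-- A nontrivial class lies in one translate of one limit set, by nesting of translates that meet,
and limit sets of cyclic groups are finite. -/
theorem finite_setOf_collapseRel (hX : IsConvergenceAction G X)
    (h3 : ∀ a b : X, ∃ c, c ≠ a ∧ c ≠ b) (hcyc : ∀ i, IsInfiniteCyclic (H i))
    (hmal : ∀ i, IsDynamicallyMalnormal X (H i)) (y : X) : {x | CollapseRel X H x y}.Finite := by
  by_cases h : ∃ i, ∃ g : G, g • y ∈ limitSet X (H i)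
  · obtain ⟨i, g, hg⟩ := h
    refine ((limitSet_finite hX h3 (hcyc i)).preimage (MulAction.injective g).injOn).subset ?_
    rintro x (rfl | ⟨k, g', hx, hy⟩)
    · exact hg
    · have := smul_mem_limitSet_of_mem hX h3 (hcyc k) (hmal i) (g := g * g'⁻¹) hy
        (by rwa [mul_smul, inv_smul_smul]) hx
      rwa [mul_smul, inv_smul_smul] at this
  · refine (Set.finite_singleton y).subset ?_
    rintro x (rfl | ⟨k, g', hx, hy⟩)
    · rfl
    · exact (h ⟨k, g', hy⟩).elim

end Collapse

theorem isInfiniteCyclic_range {C G : Type*} [Group C] [Group G] (hC : IsCyclic C)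
    (hC' : Infinite C) {f : C →* G} (hf : Function.Injective f) : IsInfiniteCyclic f.range := by
  obtain ⟨c, hc⟩ := hC.exists_generator
  refine ⟨f c, fun m n hmn => ?_, ?_⟩
  · have h1 : c ^ m = c ^ n := hf (by simpa using hmn)
    have h2 : ¬ IsOfFinOrder c := by
      rw [← orderOf_eq_zero_iff]
      rw [orderOf_eq_card_of_forall_mem_zpowers hc, Nat.card_eq_zero_of_infinite]
    exact (injective_pow_iff_not_isOfFinOrder.2 h2) h1
  · rw [← MonoidHom.map_zpowers, (Subgroup.eq_top_iff' _).2 hc, MonoidHom.range_eq_map]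

/-- A group acting in ping-pong fashion on the half-spaces of a tree, one of whose vertex groups
is a non-elementary convergence group with dynamically malnormal infinite cyclic edge groups, is
itself a non-elementary convergence group. -/
theorem IsPingPong.exists_isConvergenceAction {Γ V Ed Ω : Type*} [Group Γ] [Countable Γ]
    [MulAction Γ Ω] [Finite Ed] {s : Ed → V} {bar : Ed → Ed} {P : V → Subgroup Γ}
    {C : Ed → Subgroup Γ} {x : Ed → Γ} {Z : Ed → Set Ω} {B : V → Set Ω}
    (hΓ : IsPingPong s bar P C x Z B) {A X : Type*} [Group A] [TopologicalSpace X]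
    [CompactSpace X] [TopologicalSpace.MetrizableSpace X] [MulAction A X]
    (hX : IsConvergenceAction A X) (hne : IsNonElementary A X) {j : A →* Γ}
    (hj : Function.Injective j) {v₀ : V} (hP : j.range = P v₀)
    (hcyc : ∀ ε, s ε = v₀ → IsInfiniteCyclic ((C ε).comap j))
    (hmal : ∀ ε, s ε = v₀ → IsDynamicallyMalnormal X ((C ε).comap j)) :
    ∃ (M : Type) (_ : TopologicalSpace M) (_ : CompactSpace M)
      (_ : TopologicalSpace.MetrizableSpace M) (_ : MulAction Γ M), IsConvergenceAction Γ M ∧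
      IsNonElementary Γ M := by
  have hΛ := limitSet_top_infinite hX hne
  have h3 := three_points_of_infinite hΛ
  let H : {ε // s ε = v₀} → Subgroup A := fun ε => (C ε.1).comap j
  have hcyc' : ∀ i, IsInfiniteCyclic (H i) := fun i => hcyc i.1 i.2
  have hmal' : ∀ i, IsDynamicallyMalnormal X (H i) := fun i => hmal i.1 i.2
  obtain ⟨X', _, _, _, _, π, hπc, hπs, hπ, _, hrel⟩ := exists_collapse H hX h3 hcyc' hmal'
  have hX' : IsConvergenceAction A X' := hX.map hπc hπs hπ
  -- Since `π` has finite fibres, collapsing keeps the limit set infinite; its copy in the tree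
  -- space will witness non-elementarity.
  have hΛ' : (π '' limitSet X (⊤ : Subgroup A)).Infinite := by
    intro hfin
    refine hΛ ((hfin.preimage' fun b _ => ?_).subset (Set.subset_preimage_image π _))
    obtain ⟨y, rfl⟩ := hπs b
    refine (finite_setOf_collapseRel hX h3 hcyc' hmal' y).subset fun x hx => ?_
    exact (hrel x y).1 hx
  have h3' := three_points_of_infinite hΛ'
  choose y hy using fun i => limitSet_nonempty hX h3 (hcyc' i)
  have hfib : ∀ i x, π x = π (y i) ↔ x ∈ limitSet X (H i) := fun i x =>
    (hrel x _).trans (collapseRel_iff_mem_limitSet hX h3 hcyc' hmal' (hy i) x)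
  have := hX.nonempty
  have := hX'.nonempty
  classical
  let p : Ed → X' := fun ε => if h : s ε = v₀ then π (y ⟨ε, h⟩) else Classical.arbitrary X'
  have hp : ∀ ε (h : s ε = v₀), p ε = π (y ⟨ε, h⟩) := fun ε h => dif_pos h
  obtain ⟨d, D, hd⟩ := hΓ.exists_isDirectionMap j v₀ hP p fun ε h a ha => by
    rw [hp ε h, ← hπ, smul_eq_of_mem_limitSet hX h3 (hcyc' ⟨ε, h⟩) (hy ⟨ε, h⟩) ha]
  have hnc : ∀ γ, γ ∉ j.range → IsNonconical A (d γ) := by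
    intro γ hγ
    obtain ⟨ε, a, h, hda⟩ := hd γ hγ
    rw [hda, hp ε h]
    exact (isNonconical_of_collapse hX h3 hπc hπs hπ h3' (hcyc' ⟨ε, h⟩) (hmal' ⟨ε, h⟩)
      (hfib ⟨ε, h⟩)).smul a
  have hM := treeSpace.isConvergenceAction hX' hj D hnc
  have : CompactSpace (treeSpace j d) := isCompact_iff_compactSpace.1 isClosed_treeSpace.isCompact
  obtain ⟨M, hM₁, hM₂, hM₃, hM₄, hM₅, hM₆⟩ := hM.exists_conjugate
  refine ⟨M, hM₁, hM₂, hM₃, hM₄, hM₅, hM₆ ?_⟩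
  have hsub : treeSpaceEmbed hj D '' (π '' limitSet X (⊤ : Subgroup A)) ⊆
      limitSet (treeSpace j d) (⊤ : Subgroup Γ) := by
    refine (Set.image_mono (image_limitSet_subset hπc hπs hπ ⊤)).trans ?_
    rintro _ ⟨ξ, ⟨a, ha, -, η, hη⟩, rfl⟩
    exact ⟨fun n => j (a n), hj.comp ha, fun _ => Subgroup.mem_top _, _,
      treeSpace.convergesOff_embed hX' hj D hnc ha hη⟩
  have hinf := (hΛ'.image (treeSpaceEmbed_injective hj D).injOn).mono hsub
  unfold IsNonElementary
  rw [hinf.encard_eq]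
  exact le_top

namespace GraphOfGroups

variable {V E : Type*} {G : V → Type*} {C : E → Type*} [∀ v, Group (G v)] [∀ e, Group (C e)]
  (Y : GraphOfGroups V E G C)

theorem comap_edgeGroup (T : Set E) (ε : E × Bool)
    (h : Function.Injective (Y.toFundamentalGroup T (Y.origin ε))) :
    (Y.edgeGroup T ε).comap (Y.toFundamentalGroup T (Y.origin ε)) = (Y.edgeHom ε).range := by
  unfold edgeGroup
  rw [MonoidHom.range_comp, Subgroup.comap_map_eq_self_of_injective h]

end GraphOfGroups

end ConvGroups

theorem proposition1p4 {V E : Type*} [Finite V] [Finite E]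
    {G : V → Type*} {C : E → Type*} [∀ v, Group (G v)] [∀ e, Group (C e)]
    [∀ v, Countable (G v)]
    (Y : ConvGroups.GraphOfGroups V E G C)
    (T : Set E) (hT : Y.IsSpanningTree T)
    (X : V → Type*) [∀ v, TopologicalSpace (X v)] [∀ v, CompactSpace (X v)]
    [∀ v, TopologicalSpace.MetrizableSpace (X v)] [∀ v, MulAction (G v) (X v)]
    (hX : ∀ v, ConvGroups.IsConvergenceAction (G v) (X v))
    (hcyc : ∀ e, IsCyclic (C e) ∧ Infinite (C e))
    (hsrc : ∀ e, ConvGroups.IsDynamicallyMalnormal (X (Y.src e)) (Y.srcHom e).range)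
    (htgt : ∀ e, ConvGroups.IsDynamicallyMalnormal (X (Y.tgt e)) (Y.tgtHom e).range) :
    ∃ (M : Type) (_ : TopologicalSpace M) (_ : CompactSpace M)
      (_ : TopologicalSpace.MetrizableSpace M) (_ : MulAction (Y.FundamentalGroup T) M),
      ConvGroups.IsConvergenceAction (Y.FundamentalGroup T) M ∧
      ((∃ v, ConvGroups.IsNonElementary (G v) (X v)) →
        ConvGroups.IsNonElementary (Y.FundamentalGroup T) M) := by
  by_cases hne : ∃ v, ConvGroups.IsNonElementary (G v) (X v)
  · obtain ⟨v₀, hv₀⟩ := hne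
    obtain ⟨_, Z, B, hΓ, hinj⟩ := hT.exists_isPingPong
    obtain ⟨M, h₁, h₂, h₃, h₄, h₅, h₆⟩ := hΓ.exists_isConvergenceAction (hX v₀) hv₀ (hinj v₀)
      (v₀ := v₀) rfl
      (by
        rintro ε rfl
        rw [Y.comap_edgeGroup T ε (hinj _)]
        exact ConvGroups.isInfiniteCyclic_range (hcyc ε.1).1 (hcyc ε.1).2 (Y.edgeHom_injective ε))
      (by
        rintro ε rfl
        rw [Y.comap_edgeGroup T ε (hinj _)]
        obtain ⟨e, _ | _⟩ := ε
        · exact htgt e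
        · exact hsrc e)
    exact ⟨M, h₁, h₂, h₃, h₄, h₅, fun _ => h₆⟩
  -- With no non-elementary vertex action the second conclusion is vacuous, and the action on a
  -- point serves.
  · obtain ⟨h, h'⟩ := ConvGroups.exists_isConvergenceAction_punit (Y.FundamentalGroup T)
    exact ⟨PUnit, inferInstance, inferInstance, inferInstance, h, h', fun h => (hne h).elim⟩
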